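/- Let $\lambda,\bar\lambda,\mu,\bar\mu,b,d,\delta>0$. Let $(T_i)_{i\ge1}$, $(Y_i)_{i\ge1}$, $(\bar T_i)_{i\ge1}$, $(\bar Y_i)_{i\ge1}$ be mutually independent random variables, where the inter-claim times $T_i$ are exponential with rate $\lambda$, the claim sizes $Y_i$ exponential with mean $\mu$, the inter-premium times $\bar T_i$ exponential with rate $\bar\lambda$, and the premium sizes $\bar Y_i$ exponential with mean $\bar\mu$. Let $N_t=\#\{n\ge1: T_1+\dots+T_n\le t\}$ and $\bar N_t=\#\{n\ge1:\bar T_1+\dots+\bar T_n\le t\}$. For $x\ge0$ let the surplus process $X^b(x)$ satisfy, almost surely, $$X_t^b(x)=x+\sum_{i=1}^{\bar N_t}\bar Y_i-\sum_{i=1}^{N_t}Y_i-d\int_0^t \mathbf 1\bigl(X_s^b(x)>b\bigr)\,ds,\qquad t\ge0,$$ i.e. dividends are paid at rate $d$ while the surplus is above the threshold $b$, and a surplus that has come down to $b$ rests there until the next jump. Let $\tau_b=\inf\{t\ge0: X_t^b(x)<0\}$ (with $\inf\emptyset=\infty$) and let $$v(x)=\mathbb E\Bigl[\int_0^{\tau_b}e^{-\delta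 t}\,d\,\mathbf 1\bigl(X_t^b(x)>b\bigr)\,dt\Bigr],\qquad x\ge0,$$ be the expected discounted dividends until ruin. Put $A=\lambda+\bar\lambda+\delta$, $B=d(\bar\mu-\mu)+\mu\bar\mu A$, $G=\bar\mu(\bar\lambda+\delta)-\mu(\lambda+\delta)$, and $$D_3=G^2+4\delta\mu\bar\mu A,\qquad z_{9}=\frac{-G+\sqrt{D_3}}{2\mu\bar\mu A},\qquad z_{10}=\frac{-G-\sqrt{D_3}}{2\mu\bar\mu A},$$ $$D_4=-18\delta d\mu\bar\mu B(G-d)+4\delta B^3+B^2(G-d)^2-4d\mu\bar\mu(G-d)^3-27(\delta d\mu\bar\mu)^2 .$$ Assume $\bar\lambda\bar\mu>\lambda\mu+d$ and $D_4>0$. Then the discounted dividends until ruin are integrable for every $x\ge 0$. The cubic equation $$d\mu\bar\mu z^3+Bz^2+(G-d)z-\delta=0$$ (whose discriminant is $D_4$) has exactly two negative roots $z_{11}\ne z_{12}$. There are constants $C_9,C_{10},C_{11},C_{12}$ such that $$v(x)=C_9e^{z_9x}+C_{10}e^{z_{10}x}\quad(0\le x\le b),\qquad v(x)=C_{11}e^{z_{11}x}+C_{12}e^{z_{12}x}+\frac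 d\delta\quad(x\ge b),$$ and they satisfy the linear system $$\sum_{k=9}^{10}\Bigl(Ae^{b/\bar\mu}-\frac{\bar\lambda}{\bar\mu z_k-1}\bigl(e^{z_kb}-e^{b/\bar\mu}\bigr)\Bigr)C_k+\sum_{k=11}^{12}\frac{\bar\lambda e^{z_kb}}{\bar\mu z_k-1}C_k=\frac{d\bar\lambda}{\delta},$$ $$\sum_{k=9}^{10}\Bigl(\lambda+\delta+\frac{\lambda\bar\mu}{\mu}-\bar\mu z_kA\Bigr)C_k=0,$$ $$e^{z_9b}C_9+e^{z_{10}b}C_{10}-e^{z_{11}b}C_{11}-e^{z_{12}b}C_{12}=\frac d\delta,$$ $$\sum_{k=9}^{10}\frac{\lambda}{\mu z_k+1}\bigl(e^{-b/\mu}-e^{z_kb}\bigr)C_k+\sum_{k=11}^{12}\Bigl(A+dz_k+\frac{\bar\lambda}{\bar\mu z_k-1}\Bigr)e^{z_kb}C_k=-\frac{d\lambda}{\delta}.$$ If the determinant of this system is nonzero, the constants are its only solution. -/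

import Mathlib

open MeasureTheory ProbabilityTheory
open scoped Matrix

noncomputable section

/-- Claims `Y` with inter-claim times `T`, premiums `Yb` with inter-premium times `Tb`
(index `i : ℕ` stands for the `(i + 1)`-st claim or premium), in the model without dependence:
inter-claim times are exponential with intensity `lam`, inter-premium times exponential with
intensity `lamb`, claim and premium sizes are exponential with means `mu` and `mub`, and all these
random variables are mutually independent. -/
structure ExpRiskModel {Ω : Type*} [MeasurableSpace Ω] (P : Measure Ω) (lam lamb mu mub : ℝ)
    (T Y Tb Yb : ℕ → Ω → ℝ) : Prop where
  law_T : ∀ i, HasLaw (T i) (expMeasure lam) P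
  law_Y : ∀ i, HasLaw (Y i) (expMeasure (1 / mu)) P
  law_Tb : ∀ i, HasLaw (Tb i) (expMeasure lamb) P
  law_Yb : ∀ i, HasLaw (Yb i) (expMeasure (1 / mub)) P
  indep : iIndepFun (Sum.elim (Sum.elim T Y) (Sum.elim Tb Yb)) P

/-- The number of arrivals in `[0, t]`, for inter-arrival times `τ 0, τ 1, …`
(almost surely finite in the model). -/
def arrivalCount (τ : ℕ → ℝ) (t : ℝ) : ℕ :=
  {n : ℕ | ∑ i ∈ Finset.range (n + 1), τ i ≤ t}.ncard

/-- The total amount `∑_{i ≤ N_t} y_i` that has arrived in `[0, t]`. -/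
def aggregate (τ y : ℕ → ℝ) (t : ℝ) : ℝ :=
  ∑ i ∈ Finset.range (arrivalCount τ t), y i

/-- The rate at which dividends are paid when the surplus is `u`: it is `d` above the threshold
`b`, and `0` otherwise. At the threshold itself the surplus rests until the next jump. -/
def dividendRate (d b u : ℝ) : ℝ := if b < u then d else 0

/-- The process `X` is the surplus process with initial surplus `x` under the threshold dividend
strategy: almost surely, for all `t ≥ 0`, the surplus is the initial surplus plus the premiums
minus the claims minus the dividends paid so far. -/
def IsThresholdSurplus {Ω : Type*} [MeasurableSpace Ω] (P : Measure Ω) (d b : ℝ)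
    (T Y Tb Yb : ℕ → Ω → ℝ) (x : ℝ) (X : ℝ → Ω → ℝ) : Prop :=
  ∀ᵐ ω ∂P, ∀ t : ℝ, 0 ≤ t →
    X t ω = x + aggregate (fun i => Tb i ω) (fun i => Yb i ω) t
      - aggregate (fun i => T i ω) (fun i => Y i ω) t
      - ∫ s in (0 : ℝ)..t, dividendRate d b (X s ω)

/-- The ruin time `inf {t ≥ 0 | X_t < 0}` of a path, equal to `⊤` if there is no ruin. -/
def ruinTime (X : ℝ → ℝ) : EReal :=
  sInf ((fun t : ℝ => (t : EReal)) '' {t : ℝ | 0 ≤ t ∧ X t < 0})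

/-- The discounted dividends paid until ruin along a path, with force of interest `δ`. -/
def discountedDividends (δ d b : ℝ) (X : ℝ → ℝ) : ℝ :=
  ∫ t in {t : ℝ | 0 ≤ t ∧ (t : EReal) < ruinTime X}, Real.exp (-δ * t) * dividendRate d b (X t)

/-- The expected discounted dividends until ruin for the surplus process `X`. -/
def expectedDividends {Ω : Type*} [MeasurableSpace Ω] (P : Measure Ω) (δ d b : ℝ)
    (X : ℝ → Ω → ℝ) : ℝ :=
  ∫ ω, discountedDividends δ d b (fun t => X t ω) ∂P

/-- The left-hand side of the cubic equation of the theorem. -/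
def dividendCubic (lam lamb mu mub d δ z : ℝ) : ℝ :=
  d * mu * mub * z ^ 3 + (d * (mub - mu) + mu * mub * (lam + lamb + δ)) * z ^ 2
    + (mub * (lamb + δ) - mu * (lam + δ) - d) * z - δ

/-- The discriminant of `dividendCubic`. -/
def discD4 (lam lamb mu mub d δ : ℝ) : ℝ :=
  -18 * δ * d * mu * mub * (d * (mub - mu) + mu * mub * (lam + lamb + δ))
      * (mub * (lamb + δ) - mu * (lam + δ) - d)
    + 4 * δ * (d * (mub - mu) + mu * mub * (lam + lamb + δ)) ^ 3
    + (d * (mub - mu) + mu * mub * (lam + lamb + δ)) ^ 2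
      * (mub * (lamb + δ) - mu * (lam + δ) - d) ^ 2
    - 4 * d * mu * mub * (mub * (lamb + δ) - mu * (lam + δ) - d) ^ 3
    - 27 * (δ * d * mu * mub) ^ 2

def discD3 (lam lamb mu mub δ : ℝ) : ℝ :=
  (mub * (lamb + δ) - mu * (lam + δ)) ^ 2 + 4 * δ * mu * mub * (lam + lamb + δ)

def root9 (lam lamb mu mub δ : ℝ) : ℝ :=
  (-(mub * (lamb + δ) - mu * (lam + δ)) + Real.sqrt (discD3 lam lamb mu mub δ))
    / (2 * mu * mub * (lam + lamb + δ))

def root10 (lam lamb mu mub δ : ℝ) : ℝ :=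
  (-(mub * (lamb + δ) - mu * (lam + δ)) - Real.sqrt (discD3 lam lamb mu mub δ))
    / (2 * mu * mub * (lam + lamb + δ))

/-- The matrix of the linear system for the four constants, with exponents `z9`, `z10` on `[0, b]`
and `z11`, `z12` on `[b, ∞)`. -/
def systemMatrix (lam lamb mu mub b d δ z9 z10 z11 z12 : ℝ) : Matrix (Fin 4) (Fin 4) ℝ :=
  !![(lam + lamb + δ) * Real.exp (b / mub)
        - lamb / (mub * z9 - 1) * (Real.exp (z9 * b) - Real.exp (b / mub)),
      (lam + lamb + δ) * Real.exp (b / mub)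
        - lamb / (mub * z10 - 1) * (Real.exp (z10 * b) - Real.exp (b / mub)),
      lamb * Real.exp (z11 * b) / (mub * z11 - 1),
      lamb * Real.exp (z12 * b) / (mub * z12 - 1);
    lam + δ + lam * mub / mu - mub * z9 * (lam + lamb + δ),
      lam + δ + lam * mub / mu - mub * z10 * (lam + lamb + δ),
      0,
      0;
    Real.exp (z9 * b),
      Real.exp (z10 * b),
      -Real.exp (z11 * b),
      -Real.exp (z12 * b);
    lam / (mu * z9 + 1) * (Real.exp (-b / mu) - Real.exp (z9 * b)),
      lam / (mu * z10 + 1) * (Real.exp (-b / mu) - Real.exp (z10 * b)),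
      (lam + lamb + δ + d * z11 + lamb / (mub * z11 - 1)) * Real.exp (z11 * b),
      (lam + lamb + δ + d * z12 + lamb / (mub * z12 - 1)) * Real.exp (z12 * b)]

/-- The right-hand side of the linear system for the four constants. -/
def systemRHS (lam lamb d δ : ℝ) : Fin 4 → ℝ :=
  ![d * lamb / δ, 0, d / δ, -(d * lam / δ)]

end

/-! The value is found by verification. Between arrivals the surplus follows a deterministic flow,
and at the first arrival, which comes at rate λ + λ̄, everything restarts afresh. The expected
dividends should therefore be a fixed point of `renewalOp`, which integrates along the flow, with
weight exp (-A t), the dividend rate plus the mean value after a claim or a premium. Discounting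
makes this operator contract by the factor ρ = (λ + λ̄) / (λ + λ̄ + δ) < 1.

A combination of exponentials on either side of `b` is a fixed point once its exponents solve λ / (1
+ μ z) + λ̄ / (1 - μ̄ z) = A + e z, with e = 0 below and e = d above the threshold, and the boundary
terms of the jump integrals cancel: those of claims at `0`, of premiums across `b`, of claims across
`b`. With continuity at `b`, these conditions are the four rows of the system
(`systemSolution_of_mulVec`, `SystemSolution.renewalOp_candidate`).

The system is always solvable. A solution of the homogeneous system gives a bounded function that
solves the equation without dividends, and the contraction makes it nonnegative
(`SystemSolution.candidate_nonneg`). The same holds for its negative, so it vanishes, and so do its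
coefficients (`SystemSolution.eq_zero`). The exponents above `b` exist by sign changes of the cubic
(`exists_three_roots`).

On the side of probability, the discounted dividends of a path obey the recursion `renewalStep`
(`AdmissiblePath.exists_step`), hence lie between its iterates started from `0` and from `d / δ`.
The means of these iterates are iterates of `renewalOp` (`meanValue_iterate`) and approach the
candidate from both sides. The squeeze `lintegral_eq_of_sandwich` yields the expectation, and also
the measurability in ω, which is not assumed of `X`. -/

namespace ThresholdDividends

open Set Filter
open scoped ENNReal Topology

/-! ### Laws of the sequences of arrivals -/

/-- The sequence `a, s 0, s 1, …`. -/
def seqCons (a : ℝ) (s : ℕ → ℝ) : ℕ → ℝ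
  | 0 => a
  | n + 1 => s n

/-- The sequence `s 1, s 2, …`. -/
def seqTail (s : ℕ → ℝ) : ℕ → ℝ := fun n => s (n + 1)

@[simp] lemma seqCons_zero (a : ℝ) (s : ℕ → ℝ) : seqCons a s 0 = a := rfl

@[simp] lemma seqCons_succ (a : ℝ) (s : ℕ → ℝ) (n : ℕ) : seqCons a s (n + 1) = s n := rfl

@[simp] lemma seqTail_seqCons (a : ℝ) (s : ℕ → ℝ) : seqTail (seqCons a s) = s := rfl

@[fun_prop]
lemma measurable_seqTail : Measurable seqTail := by
  unfold seqTail; fun_prop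

lemma measurable_uncurry_seqCons : Measurable (fun q : ℝ × (ℕ → ℝ) => seqCons q.1 q.2) := by
  refine measurable_pi_iff.2 fun n => ?_
  cases n with
  | zero => exact measurable_fst
  | succ n => exact (measurable_pi_apply n).comp measurable_snd

@[fun_prop]
lemma Measurable.seqCons {α : Type*} [MeasurableSpace α] {f : α → ℝ} {g : α → ℕ → ℝ}
    (hf : Measurable f) (hg : Measurable g) : Measurable fun a => seqCons (f a) (g a) :=
  measurable_uncurry_seqCons.comp (hf.prodMk hg)

/-- The law of a sequence of independent random variables with law `μ`. -/
noncomputable abbrev iidLaw (μ : Measure ℝ) [IsProbabilityMeasure μ] : Measure (ℕ → ℝ) :=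
  Measure.infinitePi fun _ : ℕ => μ

/-- Finite cylinders determine an infinite product measure. In a cylinder the condition on
coordinate `0`, if there is one, splits off from those on the shifted coordinates. -/
lemma map_seqCons_iidLaw (μ : Measure ℝ) [IsProbabilityMeasure μ] :
    (μ.prod (iidLaw μ)).map (fun q : ℝ × (ℕ → ℝ) => seqCons q.1 q.2) = iidLaw μ := by
  classical
  refine Measure.eq_infinitePi _ fun s t ht => ?_
  rw [Measure.map_apply measurable_uncurry_seqCons
    (MeasurableSet.pi s.countable_toSet fun i _ => ht i)]
  set s' : Finset ℕ := s.preimage Nat.succ (Nat.succ_injective.injOn)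
  have hpre : (fun q : ℝ × (ℕ → ℝ) => seqCons q.1 q.2) ⁻¹' (Set.pi s t)
      = (if 0 ∈ s then t 0 else univ) ×ˢ (Set.pi s' fun i => t (i + 1)) := by
    ext q
    simp only [mem_preimage, Set.mem_pi, mem_prod, s', Finset.coe_preimage, Nat.succ_eq_add_one,
      Finset.mem_coe]
    constructor
    · intro h
      refine ⟨?_, fun i hi => h (i + 1) hi⟩
      split_ifs with h0
      · exact h 0 h0
      · trivial
    · rintro ⟨h0, h1⟩ i hi
      cases i with
      | zero => simpa [hi] using h0
      | succ i => exact h1 i hi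
  rw [hpre, Measure.prod_prod, iidLaw,
    Measure.infinitePi_pi _ (t := fun i => t (i + 1)) (fun i _ => ht _)]
  have hs : s = (if 0 ∈ s then {0} else ∅) ∪ s'.image Nat.succ := by
    ext i
    cases i with
    | zero => by_cases h : 0 ∈ s <;> simp [h]
    | succ i => by_cases h : 0 ∈ s <;> simp [h, s']
  conv_rhs => rw [hs]
  rw [Finset.prod_union, Finset.prod_image (fun a _ b _ h => Nat.succ_injective h)]
  · congr 1
    by_cases h : 0 ∈ s <;> simp [h]
  · by_cases h : 0 ∈ s <;> simp [h]

lemma lintegral_iidLaw (μ : Measure ℝ) [IsProbabilityMeasure μ] {H : (ℕ → ℝ) → ℝ≥0∞}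
    (hH : Measurable H) :
    ∫⁻ s, H s ∂iidLaw μ = ∫⁻ a, ∫⁻ s, H (seqCons a s) ∂iidLaw μ ∂μ := by
  conv_lhs => rw [← map_seqCons_iidLaw μ]
  rw [lintegral_map hH measurable_uncurry_seqCons, lintegral_prod]
  exact (hH.comp measurable_uncurry_seqCons).aemeasurable

lemma map_sumElim_infinitePi {α β : Type*} (μ : α → Measure ℝ) (ν : β → Measure ℝ)
    [∀ i, IsProbabilityMeasure (μ i)] [∀ i, IsProbabilityMeasure (ν i)]
    [∀ i, IsProbabilityMeasure (Sum.elim μ ν i)] :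
    ((Measure.infinitePi μ).prod (Measure.infinitePi ν)).map
      (fun q : (α → ℝ) × (β → ℝ) => (Sum.elim q.1 q.2 : α ⊕ β → ℝ))
      = Measure.infinitePi (Sum.elim μ ν) := by
  classical
  have hm : Measurable (fun q : (α → ℝ) × (β → ℝ) => (Sum.elim q.1 q.2 : α ⊕ β → ℝ)) := by
    refine measurable_pi_iff.2 fun i => ?_
    cases i with
    | inl i => exact (measurable_pi_apply i).comp measurable_fst
    | inr i => exact (measurable_pi_apply i).comp measurable_snd
  refine Measure.eq_infinitePi _ fun s t ht => ?_
  rw [Measure.map_apply hm (MeasurableSet.pi s.countable_toSet fun i _ => ht i)]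
  have hpre : (fun q : (α → ℝ) × (β → ℝ) => (Sum.elim q.1 q.2 : α ⊕ β → ℝ)) ⁻¹' (Set.pi s t)
      = (Set.pi s.toLeft fun i => t (.inl i)) ×ˢ (Set.pi s.toRight fun i => t (.inr i)) := by
    ext q
    simp [Set.mem_pi]
  rw [hpre, Measure.prod_prod, Measure.infinitePi_pi _ (t := fun i => t (.inl i)) (fun i _ => ht _),
    Measure.infinitePi_pi _ (t := fun i => t (.inr i)) (fun i _ => ht _)]
  conv_rhs => rw [← Finset.toLeft_disjSum_toRight (u := s), Finset.prod_disjSum]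
  rfl

/-- Inter-arrival times and sizes. -/
abbrev Arrivals : Type := (ℕ → ℝ) × (ℕ → ℝ)

/-- The law of independent iid sequences of inter-arrival times and sizes. -/
noncomputable abbrev arrivalsLaw (μ ν : Measure ℝ) [IsProbabilityMeasure μ]
    [IsProbabilityMeasure ν] : Measure Arrivals :=
  (iidLaw μ).prod (iidLaw ν)

/-- Splits off the first time and the first size; what remains has the original law. This is the
source of the renewal property. -/
lemma lintegral_arrivalsLaw (μ ν : Measure ℝ) [IsProbabilityMeasure μ] [IsProbabilityMeasure ν]
    {H : Arrivals → ℝ≥0∞} (hH : Measurable H) :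
    ∫⁻ c, H c ∂arrivalsLaw μ ν
      = ∫⁻ a, ∫⁻ y, ∫⁻ c, H (seqCons a c.1, seqCons y c.2) ∂arrivalsLaw μ ν ∂ν ∂μ := by
  rw [lintegral_prod _ hH.aemeasurable, lintegral_iidLaw]
  swap
  · exact hH.lintegral_prod_right'
  refine lintegral_congr fun a => ?_
  have h1 : ∀ s, ∫⁻ y, H (seqCons a s, y) ∂iidLaw ν
      = ∫⁻ y, ∫⁻ s', H (seqCons a s, seqCons y s') ∂iidLaw ν ∂ν := fun s =>
    lintegral_iidLaw ν (by fun_prop)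
  simp_rw [h1]
  rw [lintegral_lintegral_swap]
  · refine lintegral_congr fun y => ?_
    rw [lintegral_prod]
    exact Measurable.aemeasurable (by fun_prop)
  · refine Measurable.aemeasurable ?_
    refine Measurable.lintegral_prod_right' (f := fun q : ((ℕ → ℝ) × ℝ) × (ℕ → ℝ) =>
      H (seqCons a q.1.1, seqCons q.1.2 q.2)) ?_
    fun_prop

lemma infinitePi_map_sum {α β : Type*} (ρ : α ⊕ β → Measure ℝ) (μ : α → Measure ℝ)
    (ν : β → Measure ℝ) [∀ i, IsProbabilityMeasure (ρ i)]
    [∀ i, IsProbabilityMeasure (μ i)] [∀ i, IsProbabilityMeasure (ν i)]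
    (h : ρ = Sum.elim μ ν) :
    (Measure.infinitePi ρ).map (fun f : α ⊕ β → ℝ => (fun i => f (.inl i), fun i => f (.inr i)))
      = (Measure.infinitePi μ).prod (Measure.infinitePi ν) := by
  subst h
  have hm : Measurable (fun q : (α → ℝ) × (β → ℝ) => (Sum.elim q.1 q.2 : α ⊕ β → ℝ)) := by
    refine measurable_pi_iff.2 fun i => ?_
    cases i with
    | inl i => exact (measurable_pi_apply i).comp measurable_fst
    | inr i => exact (measurable_pi_apply i).comp measurable_snd
  rw [← map_sumElim_infinitePi, Measure.map_map (by fun_prop) hm]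
  -- Joining two families and then separating them is the identity by definition.
  exact Measure.map_id

section Model

variable {Ω : Type*} [MeasurableSpace Ω] {P : Measure Ω}
  {lam lamb mu mub : ℝ} {T Y Tb Yb : ℕ → Ω → ℝ}

lemma aemeasurable_arrivals (h : ExpRiskModel P lam lamb mu mub T Y Tb Yb) :
    AEMeasurable (fun ω => (((fun i => T i ω, fun i => Y i ω), (fun i => Tb i ω, fun i => Yb i ω)) :
      Arrivals × Arrivals)) P := by
  refine AEMeasurable.prodMk (AEMeasurable.prodMk ?_ ?_) (AEMeasurable.prodMk ?_ ?_) <;>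
    refine aemeasurable_pi_iff.2 fun i => ?_
  exacts [(h.law_T i).aemeasurable, (h.law_Y i).aemeasurable, (h.law_Tb i).aemeasurable,
    (h.law_Yb i).aemeasurable]

/-- Independence makes the joint law an infinite product over (ℕ ⊕ ℕ) ⊕ (ℕ ⊕ ℕ). Splitting the index
set at the outer sum and then at both inner ones leaves four iid sequences. -/
lemma map_arrivals [IsProbabilityMeasure P] (h : ExpRiskModel P lam lamb mu mub T Y Tb Yb)
    [IsProbabilityMeasure (expMeasure lam)] [IsProbabilityMeasure (expMeasure (1 / mu))]
    [IsProbabilityMeasure (expMeasure lamb)] [IsProbabilityMeasure (expMeasure (1 / mub))] :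
    P.map (fun ω => (((fun i => T i ω, fun i => Y i ω), (fun i => Tb i ω, fun i => Yb i ω)) :
      Arrivals × Arrivals))
      = (arrivalsLaw (expMeasure lam) (expMeasure (1 / mu))).prod
        (arrivalsLaw (expMeasure lamb) (expMeasure (1 / mub))) := by
  set Z := Sum.elim (Sum.elim T Y) (Sum.elim Tb Yb)
  have hae : ∀ i, AEMeasurable (Z i) P := by
    rintro ((i | i) | (i | i))
    exacts [(h.law_T i).aemeasurable, (h.law_Y i).aemeasurable, (h.law_Tb i).aemeasurable,
      (h.law_Yb i).aemeasurable]
  have hlaw := h.indep.map_fun_eq_infinitePi_map₀' hae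
  have hprob : ∀ i, IsProbabilityMeasure (P.map (Z i)) :=
    fun i => Measure.isProbabilityMeasure_map (hae i)
  have hTY : ∀ i : ℕ ⊕ ℕ, IsProbabilityMeasure (Sum.elim (fun _ : ℕ => expMeasure lam)
      (fun _ : ℕ => expMeasure (1 / mu)) i) := by
    rintro (i | i) <;> simp only [Sum.elim_inl, Sum.elim_inr] <;> infer_instance
  have hTYb : ∀ i : ℕ ⊕ ℕ, IsProbabilityMeasure (Sum.elim (fun _ : ℕ => expMeasure lamb)
      (fun _ : ℕ => expMeasure (1 / mub)) i) := by
    rintro (i | i) <;> simp only [Sum.elim_inl, Sum.elim_inr] <;> infer_instance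
  have h1 := infinitePi_map_sum (fun i => P.map (Z i)) _ _
    (show (fun i => P.map (Z i)) = Sum.elim (Sum.elim (fun _ : ℕ => expMeasure lam)
        (fun _ : ℕ => expMeasure (1 / mu))) (Sum.elim (fun _ : ℕ => expMeasure lamb)
        (fun _ : ℕ => expMeasure (1 / mub))) by
      funext i
      rcases i with ((i | i) | (i | i))
      exacts [(h.law_T i).map_eq, (h.law_Y i).map_eq, (h.law_Tb i).map_eq, (h.law_Yb i).map_eq])
  have h2 := infinitePi_map_sum _ (fun _ : ℕ => expMeasure lam)
    (fun _ : ℕ => expMeasure (1 / mu)) rfl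
  have h3 := infinitePi_map_sum _ (fun _ : ℕ => expMeasure lamb)
    (fun _ : ℕ => expMeasure (1 / mub)) rfl
  unfold arrivalsLaw iidLaw
  rw [← h2, ← h3, Measure.map_prod_map _ _ (by fun_prop) (by fun_prop), ← h1, ← hlaw,
    AEMeasurable.map_map_of_aemeasurable, AEMeasurable.map_map_of_aemeasurable]
  · rfl
  · exact ((by fun_prop : Measurable _).comp (by fun_prop)).aemeasurable
  · exact aemeasurable_pi_iff.2 hae
  · exact Measurable.aemeasurable (by fun_prop)
  · exact Measurable.aemeasurable (by fun_prop)

end Model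

/-! ### Exponential laws: lack of memory and the race for the first arrival -/

lemma lintegral_expMeasure (r : ℝ) {f : ℝ → ℝ≥0∞} (hf : Measurable f) :
    ∫⁻ x, f x ∂expMeasure r = ∫⁻ x in Ioi 0, ENNReal.ofReal (r * Real.exp (-(r * x))) * f x := by
  have h0 : expMeasure r = volume.withDensity (exponentialPDF r) := rfl
  rw [h0, lintegral_withDensity_eq_lintegral_mul _ _ hf,
    ← setLIntegral_congr (Ioi_ae_eq_Ici (a := (0 : ℝ))).symm, ← lintegral_indicator measurableSet_Ici]
  · refine lintegral_congr fun x => ?_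
    by_cases hx : 0 ≤ x
    · simp [hx, exponentialPDF_of_nonneg hx]
    · simp [hx, exponentialPDF_of_neg (not_le.1 hx)]
  · exact (measurable_exponentialPDFReal r).ennreal_ofReal

lemma ae_pos_expMeasure (r : ℝ) : ∀ᵐ x ∂expMeasure r, 0 < x := by
  have h : ∫⁻ x, (Iic 0).indicator 1 x ∂expMeasure r = 0 := by
    rw [lintegral_expMeasure r (measurable_one.indicator measurableSet_Iic)]
    rw [setLIntegral_congr_fun (g := fun _ => 0) measurableSet_Ioi]
    · simp
    · intro x hx
      simp [show ¬ x ≤ 0 from not_le.2 hx]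
  rw [lintegral_indicator_one measurableSet_Iic] at h
  rw [ae_iff]
  simpa [Iic] using h

lemma ae_ne_expMeasure (r a : ℝ) : ∀ᵐ x ∂expMeasure r, x ≠ a := by
  have h : ∀ᵐ x ∂(volume : Measure ℝ), x ≠ a := by
    simp [ae_iff]
  exact (withDensity_absolutelyContinuous volume (exponentialPDF r)).ae_le h

lemma setLIntegral_Ioi_comp_sub (a : ℝ) (f : ℝ → ℝ≥0∞) :
    ∫⁻ x in Ioi a, f (x - a) = ∫⁻ x in Ioi 0, f x := by
  rw [← lintegral_indicator measurableSet_Ioi, ← lintegral_indicator measurableSet_Ioi,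
    ← lintegral_sub_right_eq_self ((Ioi 0).indicator fun x => f x) a]
  refine lintegral_congr fun x => ?_
  simp [indicator]

lemma lintegral_expMeasure_memoryless {r a : ℝ} (ha : 0 ≤ a) {H : ℝ → ℝ≥0∞}
    (hH : Measurable H) :
    ∫⁻ x, (Ioi a).indicator (fun x => H (x - a)) x ∂expMeasure r
      = ENNReal.ofReal (Real.exp (-(r * a))) * ∫⁻ x, H x ∂expMeasure r := by
  have hm : Measurable fun x => H (x - a) := by fun_prop
  rw [lintegral_expMeasure r (hm.indicator measurableSet_Ioi),
    lintegral_expMeasure r hH, ← lintegral_const_mul' _ _ ENNReal.ofReal_ne_top,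
    ← setLIntegral_Ioi_comp_sub a fun x => ENNReal.ofReal (Real.exp (-(r * a))) *
      (ENNReal.ofReal (r * Real.exp (-(r * x))) * H x)]
  have : ∀ x, ENNReal.ofReal (r * Real.exp (-(r * x))) * (Ioi a).indicator (fun x => H (x - a)) x
      = (Ioi a).indicator (fun x => ENNReal.ofReal (r * Real.exp (-(r * x))) * H (x - a)) x := by
    intro x; by_cases hx : x ∈ Ioi a <;> simp [hx]
  simp_rw [this]
  rw [setLIntegral_indicator measurableSet_Ioi, inter_eq_left.2 (Ioi_subset_Ioi ha)]
  refine setLIntegral_congr_fun measurableSet_Ioi fun x hx => ?_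
  rw [← mul_assoc, ← ENNReal.ofReal_mul (Real.exp_pos _).le]
  congr 2
  rw [mul_left_comm, ← Real.exp_add]
  congr 2; ring

/-- The arrivals after the first one. -/
def dropFirst (c : Arrivals) : Arrivals := (seqTail c.1, seqTail c.2)

/-- The arrivals seen from time `a`, when the first one comes after `a`. -/
def elapse (a : ℝ) (c : Arrivals) : Arrivals := (seqCons (c.1 0 - a) (seqTail c.1), c.2)

@[fun_prop]
lemma measurable_dropFirst : Measurable dropFirst := by
  unfold dropFirst; fun_prop

@[fun_prop]
lemma Measurable.elapse {α : Type*} [MeasurableSpace α] {f : α → ℝ} {g : α → Arrivals}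
    (hf : Measurable f) (hg : Measurable g) : Measurable fun a => elapse (f a) (g a) := by
  unfold ThresholdDividends.elapse; fun_prop

section Race

variable {r s : ℝ} {ν ν' : Measure ℝ} [IsProbabilityMeasure (expMeasure r)]
  [IsProbabilityMeasure (expMeasure s)] [IsProbabilityMeasure ν] [IsProbabilityMeasure ν']

/-- Lack of memory: the first arrival comes after `a` with probability exp (-s a), and then the
residual arrivals have the original law. Ties have probability zero, so `R` may be `<` or `≤`; both
occur, since `renewalStep` assigns ties to the premiums. -/
lemma lintegral_elapse {R : ℝ → ℝ → Prop} [DecidableRel R] (hR : ∀ a b, a < b → R a b)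
    (hR' : ∀ a b, b < a → ¬ R a b) {a : ℝ} (ha : 0 ≤ a) {H : Arrivals → ℝ≥0∞}
    (hH : Measurable H) :
    ∫⁻ p, (if R a (p.1 0) then H (elapse a p) else 0) ∂arrivalsLaw (expMeasure s) ν'
      = ENNReal.ofReal (Real.exp (-(s * a))) * ∫⁻ p, H p ∂arrivalsLaw (expMeasure s) ν' := by
  have hRae : ∀ᵐ p ∂arrivalsLaw (expMeasure s) ν', (if R a (p.1 0) then H (elapse a p) else 0)
      = if a < p.1 0 then H (elapse a p) else 0 := by
    have h1 : ∀ᵐ x ∂((arrivalsLaw (expMeasure s) ν').map fun p => p.1 0), x ≠ a := by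
      have : (arrivalsLaw (expMeasure s) ν').map (fun p => p.1 0) = expMeasure s := by
        have h2 : (fun p : Arrivals => p.1 0) = (fun f => f 0) ∘ Prod.fst := rfl
        rw [h2, ← Measure.map_map (by fun_prop) (by fun_prop), Measure.map_fst_prod]
        simp [iidLaw, Measure.infinitePi_map_eval]
      rw [this]
      exact ae_ne_expMeasure s a
    filter_upwards [ae_of_ae_map (by fun_prop) h1] with p hp
    rcases lt_or_gt_of_ne hp with h | h
    · rw [if_neg (hR' _ _ h), if_neg h.le.not_gt]
    · rw [if_pos (hR _ _ h), if_pos h]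
  rw [lintegral_congr_ae hRae, lintegral_arrivalsLaw, lintegral_arrivalsLaw _ _ hH]
  · rw [← lintegral_expMeasure_memoryless ha]
    · refine lintegral_congr fun x => ?_
      by_cases hx : a < x <;> simp [hx, elapse]
    · refine Measurable.lintegral_prod_right' (f := fun q : ℝ × ℝ =>
        ∫⁻ c, H (seqCons q.1 c.1, seqCons q.2 c.2) ∂arrivalsLaw (expMeasure s) ν') ?_
      refine Measurable.lintegral_prod_right' (f := fun q : (ℝ × ℝ) × Arrivals =>
        H (seqCons q.1.1 q.2.1, seqCons q.1.2 q.2.2)) ?_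
      fun_prop
  · exact Measurable.ite (measurableSet_lt (by fun_prop) (by fun_prop)) (by fun_prop) (by fun_prop)

/-- Two independent arrival processes with exponential inter-arrival times: the contribution of
the event that the first one has the first arrival. -/
lemma lintegral_race {R : ℝ → ℝ → Prop} [DecidableRel R] (hR : ∀ a b, a < b → R a b)
    (hR' : ∀ a b, b < a → ¬ R a b) (hr : 0 < r)
    {G : ℝ × ℝ × Arrivals × Arrivals → ℝ≥0∞} (hG : Measurable G) :
    ∫⁻ c, ∫⁻ p, (if R (c.1 0) (p.1 0) then G (c.1 0, c.2 0, dropFirst c, elapse (c.1 0) p) else 0)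
        ∂arrivalsLaw (expMeasure s) ν' ∂arrivalsLaw (expMeasure r) ν
      = ∫⁻ t in Ioi 0, ENNReal.ofReal (Real.exp (-((r + s) * t))) * (ENNReal.ofReal r *
          ∫⁻ y, ∫⁻ c, ∫⁻ p, G (t, y, c, p)
            ∂arrivalsLaw (expMeasure s) ν' ∂arrivalsLaw (expMeasure r) ν ∂ν) := by
  have hpos : ∀ᵐ c ∂arrivalsLaw (expMeasure r) ν, 0 < c.1 0 := by
    have : (arrivalsLaw (expMeasure r) ν).map (fun p => p.1 0) = expMeasure r := by
      have h2 : (fun p : Arrivals => p.1 0) = (fun f => f 0) ∘ Prod.fst := rfl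
      rw [h2, ← Measure.map_map (by fun_prop) (by fun_prop), Measure.map_fst_prod]
      simp [iidLaw, Measure.infinitePi_map_eval]
    refine ae_of_ae_map (f := fun p : Arrivals => p.1 0) (by fun_prop) ?_
    rw [this]
    exact ae_pos_expMeasure r
  have hm1 : Measurable fun q : ℝ × ℝ × Arrivals =>
      ∫⁻ p, G (q.1, q.2.1, q.2.2, p) ∂arrivalsLaw (expMeasure s) ν' :=
    Measurable.lintegral_prod_right' (f := fun z : (ℝ × ℝ × Arrivals) × Arrivals =>
        G (z.1.1, z.1.2.1, z.1.2.2, z.2)) (by fun_prop)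
  have hm2 : Measurable fun q : ℝ × ℝ =>
      ∫⁻ c, ∫⁻ p, G (q.1, q.2, c, p) ∂arrivalsLaw (expMeasure s) ν'
        ∂arrivalsLaw (expMeasure r) ν :=
    Measurable.lintegral_prod_right' (f := fun z : (ℝ × ℝ) × Arrivals =>
      ∫⁻ p, G (z.1.1, z.1.2, z.2, p) ∂arrivalsLaw (expMeasure s) ν') (by fun_prop)
  -- For a fixed winner `c`, the loser `p` is seen from time `c.1 0` and is renewed by lack of
  -- memory.
  have h1 : ∀ᵐ c ∂arrivalsLaw (expMeasure r) ν,
      ∫⁻ p, (if R (c.1 0) (p.1 0) then G (c.1 0, c.2 0, dropFirst c, elapse (c.1 0) p) else 0)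
        ∂arrivalsLaw (expMeasure s) ν'
      = ENNReal.ofReal (Real.exp (-(s * c.1 0))) * ∫⁻ p, G (c.1 0, c.2 0, dropFirst c, p)
        ∂arrivalsLaw (expMeasure s) ν' := by
    filter_upwards [hpos] with c hc
    exact lintegral_elapse hR hR' hc.le (H := fun p => G (c.1 0, c.2 0, dropFirst c, p))
      (by fun_prop)
  rw [lintegral_congr_ae h1, lintegral_arrivalsLaw _ _ (by fun_prop)]
  simp only [seqCons_zero, dropFirst, seqTail_seqCons]
  have h2 : ∀ a, ∫⁻ y, ∫⁻ c, ENNReal.ofReal (Real.exp (-(s * a))) *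
      ∫⁻ p, G (a, y, (c.1, c.2), p) ∂arrivalsLaw (expMeasure s) ν' ∂arrivalsLaw (expMeasure r) ν ∂ν
      = ENNReal.ofReal (Real.exp (-(s * a))) * ∫⁻ y, ∫⁻ c, ∫⁻ p, G (a, y, (c.1, c.2), p)
        ∂arrivalsLaw (expMeasure s) ν' ∂arrivalsLaw (expMeasure r) ν ∂ν := by
    intro a
    rw [← lintegral_const_mul' _ _ ENNReal.ofReal_ne_top]
    refine lintegral_congr fun y => ?_
    rw [← lintegral_const_mul' _ _ ENNReal.ofReal_ne_top]
  simp_rw [h2]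
  rw [lintegral_expMeasure]
  · refine setLIntegral_congr_fun measurableSet_Ioi fun t ht => ?_
    rw [← mul_assoc, ← mul_assoc, ← ENNReal.ofReal_mul (by positivity),
      ← ENNReal.ofReal_mul (by positivity)]
    congr 2
    rw [mul_assoc, ← Real.exp_add, mul_comm]
    congr 2; ring
  · have := hm2.lintegral_prod_right' (ν := ν)
    fun_prop

end Race

/-! ### The renewal recursion and its mean -/

/-- The surplus at time `t` if it is `x` at time `0` and nothing arrives in `[0, t]`. -/
noncomputable def flow (d b x t : ℝ) : ℝ := max (min x b) (x - d * t)

@[fun_prop]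
lemma Measurable.flow {α : Type*} [MeasurableSpace α] {d b : ℝ} {f g : α → ℝ}
    (hf : Measurable f) (hg : Measurable g) : Measurable fun a => flow d b (f a) (g a) := by
  unfold ThresholdDividends.flow; fun_prop

@[fun_prop]
lemma measurable_dividendRate (d b : ℝ) : Measurable (dividendRate d b) :=
  Measurable.ite measurableSet_Ioi measurable_const measurable_const

lemma dividendRate_nonneg {d : ℝ} (hd : 0 ≤ d) (b u : ℝ) : 0 ≤ dividendRate d b u := by
  unfold dividendRate; split_ifs <;> simp [hd]

lemma dividendRate_le {d : ℝ} (hd : 0 ≤ d) (b u : ℝ) : dividendRate d b u ≤ d := by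
  unfold dividendRate; split_ifs <;> simp [hd]

/-- The discounted dividends up to the first arrival, plus the value `F` of the continuation. -/
noncomputable def renewalStep (δ d b : ℝ) (F : ℝ × Arrivals × Arrivals → ℝ≥0∞)
    (q : ℝ × Arrivals × Arrivals) : ℝ≥0∞ :=
  if q.1 < 0 then 0 else
    (∫⁻ t in Ioi 0, if t < q.2.1.1 0 ∧ t < q.2.2.1 0 then
      ENNReal.ofReal (Real.exp (-(δ * t)) * dividendRate d b (flow d b q.1 t)) else 0) +
    if q.2.1.1 0 < q.2.2.1 0 then
      ENNReal.ofReal (Real.exp (-(δ * q.2.1.1 0))) *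
        F (flow d b q.1 (q.2.1.1 0) - q.2.1.2 0, dropFirst q.2.1, elapse (q.2.1.1 0) q.2.2)
    else
      ENNReal.ofReal (Real.exp (-(δ * q.2.2.1 0))) *
        F (flow d b q.1 (q.2.2.1 0) + q.2.2.2 0, elapse (q.2.2.1 0) q.2.1, dropFirst q.2.2)

lemma measurable_renewalStep {δ d b : ℝ} {F : ℝ × Arrivals × Arrivals → ℝ≥0∞}
    (hF : Measurable F) : Measurable (renewalStep δ d b F) := by
  unfold renewalStep
  refine Measurable.ite (measurableSet_lt (by fun_prop) (by fun_prop)) measurable_const ?_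
  refine Measurable.add ?_ (Measurable.ite (measurableSet_lt (by fun_prop) (by fun_prop))
    (by fun_prop) (by fun_prop))
  refine Measurable.lintegral_prod_right' (f := fun z : (ℝ × Arrivals × Arrivals) × ℝ =>
    if z.2 < z.1.2.1.1 0 ∧ z.2 < z.1.2.2.1 0 then
      ENNReal.ofReal (Real.exp (-(δ * z.2)) * dividendRate d b (flow d b z.1.1 z.2)) else 0) ?_
  refine Measurable.ite ?_ (by fun_prop) measurable_const
  rw [ofPred_and]
  exact MeasurableSet.inter (measurableSet_lt (by fun_prop) (by fun_prop))
    (measurableSet_lt (by fun_prop) (by fun_prop))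

/-- The operator of which the expected discounted dividends are the fixed point. -/
noncomputable def renewalOp (δ d b lam lamb : ℝ) (ν ν' : Measure ℝ) (u : ℝ → ℝ≥0∞) (x : ℝ) :
    ℝ≥0∞ :=
  if x < 0 then 0 else
    ∫⁻ t in Ioi 0, ENNReal.ofReal (Real.exp (-((lam + lamb + δ) * t))) *
      (ENNReal.ofReal (dividendRate d b (flow d b x t)) +
        (ENNReal.ofReal lam * ∫⁻ y, u (flow d b x t - y) ∂ν +
          ENNReal.ofReal lamb * ∫⁻ y, u (flow d b x t + y) ∂ν'))

/-- The expectation over the arrivals. -/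
noncomputable def meanValue (Q Q' : Measure Arrivals) (F : ℝ × Arrivals × Arrivals → ℝ≥0∞)
    (x : ℝ) : ℝ≥0∞ :=
  ∫⁻ c, ∫⁻ p, F (x, c, p) ∂Q' ∂Q

lemma lintegral_arrivalsLaw_survival {r t : ℝ} {ν : Measure ℝ} [IsProbabilityMeasure ν]
    [IsProbabilityMeasure (expMeasure r)] (ht : 0 ≤ t) (g : ℝ≥0∞) :
    ∫⁻ c, (if t < c.1 0 then g else 0) ∂arrivalsLaw (expMeasure r) ν
      = ENNReal.ofReal (Real.exp (-(r * t))) * g := by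
  have h := lintegral_elapse (s := r) (ν' := ν) (R := fun a b => a < b) (fun a b h => h)
    (fun a b h => h.not_gt) ht (H := fun _ => g) measurable_const
  simpa using h

/-- No arrival has come by time `t` with probability exp (-(λ + λ̄) t), the weight of the running
dividends. The first arrival is a claim with density λ exp (-(λ + λ̄) t) and a premium with density
λ̄ exp (-(λ + λ̄) t), and the later arrivals are then fresh. The discount adds δ to the exponent. -/
lemma meanValue_renewalStep {δ d b lam lamb : ℝ} {ν ν' : Measure ℝ} [IsProbabilityMeasure ν]
    [IsProbabilityMeasure ν'] [IsProbabilityMeasure (expMeasure lam)]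
    [IsProbabilityMeasure (expMeasure lamb)] (hlam : 0 < lam) (hlamb : 0 < lamb)
    {F : ℝ × Arrivals × Arrivals → ℝ≥0∞} (hF : Measurable F) (x : ℝ) :
    meanValue (arrivalsLaw (expMeasure lam) ν) (arrivalsLaw (expMeasure lamb) ν')
        (renewalStep δ d b F) x
      = renewalOp δ d b lam lamb ν ν' (meanValue (arrivalsLaw (expMeasure lam) ν)
        (arrivalsLaw (expMeasure lamb) ν') F) x := by
  unfold meanValue renewalOp renewalStep
  split_ifs with hx
  · simp
  simp only
  set Q := arrivalsLaw (expMeasure lam) ν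
  set Q' := arrivalsLaw (expMeasure lamb) ν'
  set g : ℝ → ℝ≥0∞ := fun t =>
    ENNReal.ofReal (Real.exp (-(δ * t)) * dividendRate d b (flow d b x t)) with hg
  have hgm : Measurable g := by fun_prop
  -- The case distinction becomes a sum, so that each summand is a race won by one side.
  set J₁ : Arrivals → Arrivals → ℝ≥0∞ := fun c p => if c.1 0 < p.1 0 then
    ENNReal.ofReal (Real.exp (-(δ * c.1 0))) *
      F (flow d b x (c.1 0) - c.2 0, dropFirst c, elapse (c.1 0) p) else 0 with hJ₁
  set J₂ : Arrivals → Arrivals → ℝ≥0∞ := fun c p => if p.1 0 ≤ c.1 0 then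
    ENNReal.ofReal (Real.exp (-(δ * p.1 0))) *
      F (flow d b x (p.1 0) + p.2 0, elapse (p.1 0) c, dropFirst p) else 0 with hJ₂
  have hJ₁m : Measurable (Function.uncurry J₁) :=
    Measurable.ite (measurableSet_lt (by fun_prop) (by fun_prop)) (by fun_prop) measurable_const
  have hJ₂m : Measurable (Function.uncurry J₂) :=
    Measurable.ite (measurableSet_le (by fun_prop) (by fun_prop)) (by fun_prop) measurable_const
  have hg3 : Measurable fun z : (Arrivals × Arrivals) × ℝ =>
      (if z.2 < z.1.1.1 0 ∧ z.2 < z.1.2.1 0 then g z.2 else 0) := by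
    refine Measurable.ite ?_ (by fun_prop) measurable_const
    rw [ofPred_and]
    exact MeasurableSet.inter (measurableSet_lt (by fun_prop) (by fun_prop))
      (measurableSet_lt (by fun_prop) (by fun_prop))
  have hIm : Measurable fun z : Arrivals × Arrivals =>
      ∫⁻ t in Ioi 0, (if t < z.1.1 0 ∧ t < z.2.1 0 then g t else 0) :=
    Measurable.lintegral_prod_right' hg3
  have hsplit : ∀ c p, ((∫⁻ t in Ioi 0, if t < c.1 0 ∧ t < p.1 0 then g t else 0) +
      if c.1 0 < p.1 0 then ENNReal.ofReal (Real.exp (-(δ * c.1 0))) *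
        F (flow d b x (c.1 0) - c.2 0, dropFirst c, elapse (c.1 0) p)
      else ENNReal.ofReal (Real.exp (-(δ * p.1 0))) *
        F (flow d b x (p.1 0) + p.2 0, elapse (p.1 0) c, dropFirst p))
      = (∫⁻ t in Ioi 0, if t < c.1 0 ∧ t < p.1 0 then g t else 0) + (J₁ c p + J₂ c p) := by
    intro c p
    simp only [hJ₁, hJ₂]
    by_cases h : c.1 0 < p.1 0
    · simp [h, h.not_ge]
    · simp [h, not_lt.1 h]
  refine (lintegral_congr fun c => lintegral_congr fun p => hsplit c p).trans ?_
  have hI : ∫⁻ c, ∫⁻ p, (∫⁻ t in Ioi 0, (if t < c.1 0 ∧ t < p.1 0 then g t else 0)) ∂Q' ∂Q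
      = ∫⁻ t in Ioi 0, ENNReal.ofReal (Real.exp (-((lam + lamb) * t))) * g t := by
    rw [← lintegral_prod (fun z : Arrivals × Arrivals =>
        ∫⁻ t in Ioi 0, (if t < z.1.1 0 ∧ t < z.2.1 0 then g t else 0)) hIm.aemeasurable,
      lintegral_lintegral_swap hg3.aemeasurable]
    refine setLIntegral_congr_fun measurableSet_Ioi fun t ht => ?_
    have ht' : (0 : ℝ) ≤ t := le_of_lt ht
    rw [lintegral_prod]
    swap
    · exact (hg3.comp (measurable_id.prodMk measurable_const)).aemeasurable
    have h1 : ∀ c : Arrivals, ∫⁻ p, (if t < c.1 0 ∧ t < p.1 0 then g t else 0) ∂Q'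
        = if t < c.1 0 then ENNReal.ofReal (Real.exp (-(lamb * t))) * g t else 0 := by
      intro c
      by_cases hc : t < c.1 0
      · simp only [hc, true_and, if_true]
        exact lintegral_arrivalsLaw_survival ht' _
      · simp [hc]
    simp_rw [h1]
    rw [lintegral_arrivalsLaw_survival ht', ← mul_assoc,
      ← ENNReal.ofReal_mul (Real.exp_pos _).le, ← Real.exp_add]
    congr 3; ring
  have h₁ : ∫⁻ c, ∫⁻ p, J₁ c p ∂Q' ∂Q
      = ∫⁻ t in Ioi 0, ENNReal.ofReal (Real.exp (-((lam + lamb) * t))) * (ENNReal.ofReal lam *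
          ∫⁻ y, ∫⁻ c, ∫⁻ p, ENNReal.ofReal (Real.exp (-(δ * t))) * F (flow d b x t - y, c, p)
            ∂Q' ∂Q ∂ν) :=
    lintegral_race (R := fun a b => a < b) (fun a b h => h) (fun a b h => h.not_gt) hlam
      (G := fun z => ENNReal.ofReal (Real.exp (-(δ * z.1))) *
        F (flow d b x z.1 - z.2.1, z.2.2.1, z.2.2.2)) (by fun_prop)
  have h₂ : ∫⁻ c, ∫⁻ p, J₂ c p ∂Q' ∂Q
      = ∫⁻ t in Ioi 0, ENNReal.ofReal (Real.exp (-((lamb + lam) * t))) * (ENNReal.ofReal lamb *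
          ∫⁻ y, ∫⁻ p, ∫⁻ c, ENNReal.ofReal (Real.exp (-(δ * t))) * F (flow d b x t + y, c, p)
            ∂Q ∂Q' ∂ν') := by
    -- The premiums win here, so they have to be the outer variable of `lintegral_race`.
    rw [lintegral_lintegral_swap hJ₂m.aemeasurable]
    exact lintegral_race (R := fun a b => a ≤ b) (fun a b h => h.le) (fun a b h => h.not_ge) hlamb
      (G := fun z => ENNReal.ofReal (Real.exp (-(δ * z.1))) *
        F (flow d b x z.1 + z.2.1, z.2.2.2, z.2.2.1)) (by fun_prop)
  have hsw : ∀ z, ∫⁻ p, ∫⁻ c, F (z, c, p) ∂Q ∂Q' = ∫⁻ c, ∫⁻ p, F (z, c, p) ∂Q' ∂Q := fun z =>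
    lintegral_lintegral_swap (Measurable.aemeasurable (by fun_prop))
  have hsum : ∫⁻ c, ∫⁻ p, ((∫⁻ t in Ioi 0, if t < c.1 0 ∧ t < p.1 0 then g t else 0) +
      (J₁ c p + J₂ c p)) ∂Q' ∂Q
      = (∫⁻ c, ∫⁻ p, (∫⁻ t in Ioi 0, (if t < c.1 0 ∧ t < p.1 0 then g t else 0)) ∂Q' ∂Q)
        + ((∫⁻ c, ∫⁻ p, J₁ c p ∂Q' ∂Q) + ∫⁻ c, ∫⁻ p, J₂ c p ∂Q' ∂Q) := by
    refine (lintegral_lintegral (hIm.add (hJ₁m.add hJ₂m)).aemeasurable).trans ?_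
    refine (lintegral_add_left hIm _).trans ?_
    congr 1
    · exact lintegral_prod _ hIm.aemeasurable
    · refine (lintegral_add_left hJ₁m _).trans ?_
      congr 1
      · exact lintegral_prod _ hJ₁m.aemeasurable
      · exact lintegral_prod _ hJ₂m.aemeasurable
  have hFm : Measurable fun z : ℝ => ∫⁻ c, ∫⁻ p, F (z, c, p) ∂Q' ∂Q := by
    refine Measurable.lintegral_prod_right' (f := fun q : ℝ × Arrivals =>
      ∫⁻ p, F (q.1, q.2, p) ∂Q') ?_
    exact Measurable.lintegral_prod_right' (f := fun q : (ℝ × Arrivals) × Arrivals =>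
      F (q.1.1, q.1.2, q.2)) (by fun_prop)
  have hFν : Measurable fun t : ℝ => ∫⁻ y, ∫⁻ c, ∫⁻ p, F (flow d b x t - y, c, p) ∂Q' ∂Q ∂ν :=
    Measurable.lintegral_prod_right' (f := fun q : ℝ × ℝ =>
      ∫⁻ c, ∫⁻ p, F (flow d b x q.1 - q.2, c, p) ∂Q' ∂Q)
      (hFm.comp (g := fun z : ℝ => ∫⁻ c, ∫⁻ p, F (z, c, p) ∂Q' ∂Q)
        (f := fun q : ℝ × ℝ => flow d b x q.1 - q.2) (by fun_prop))
  have hc₁ : ∀ t, ∫⁻ y, ∫⁻ c, ∫⁻ p, ENNReal.ofReal (Real.exp (-(δ * t))) *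
      F (flow d b x t - y, c, p) ∂Q' ∂Q ∂ν = ENNReal.ofReal (Real.exp (-(δ * t))) *
      ∫⁻ y, ∫⁻ c, ∫⁻ p, F (flow d b x t - y, c, p) ∂Q' ∂Q ∂ν := by
    intro t
    simp_rw [lintegral_const_mul' _ _ ENNReal.ofReal_ne_top]
  have hc₂ : ∀ t, ∫⁻ y, ∫⁻ p, ∫⁻ c, ENNReal.ofReal (Real.exp (-(δ * t))) *
      F (flow d b x t + y, c, p) ∂Q ∂Q' ∂ν' = ENNReal.ofReal (Real.exp (-(δ * t))) *
      ∫⁻ y, ∫⁻ c, ∫⁻ p, F (flow d b x t + y, c, p) ∂Q' ∂Q ∂ν' := by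
    intro t
    simp_rw [lintegral_const_mul' _ _ ENNReal.ofReal_ne_top, hsw]
  rw [hsum, hI, h₁, h₂]
  simp_rw [hc₁, hc₂]
  rw [← lintegral_add_left (by fun_prop), ← lintegral_add_left (by fun_prop)]
  refine lintegral_congr fun t => ?_
  have he : ENNReal.ofReal (Real.exp (-((lam + lamb + δ) * t)))
      = ENNReal.ofReal (Real.exp (-((lam + lamb) * t))) *
        ENNReal.ofReal (Real.exp (-(δ * t))) := by
    rw [← ENNReal.ofReal_mul (Real.exp_pos _).le, ← Real.exp_add]
    congr 2; ring
  rw [he, add_comm lamb lam, hg]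
  simp only [ENNReal.ofReal_mul (Real.exp_pos _).le]
  ring

/-! ### Surplus paths up to the first arrival and their restart -/

/-- Nonnegative inter-arrival times and sizes, with finitely many arrivals in bounded time. -/
structure RegularArrivals (c : Arrivals) : Prop where
  finite : ∀ t, {n : ℕ | ∑ i ∈ Finset.range (n + 1), c.1 i ≤ t}.Finite
  time_nonneg : ∀ i, 0 ≤ c.1 i
  size_nonneg : ∀ i, 0 ≤ c.2 i

lemma sum_seqTail (s : ℕ → ℝ) (n : ℕ) :
    ∑ i ∈ Finset.range (n + 1), seqTail s i = ∑ i ∈ Finset.range (n + 2), s i - s 0 := by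
  rw [Finset.sum_range_succ' s (n + 1)]
  simp [seqTail]

lemma sum_elapse (a : ℝ) (c : Arrivals) (n : ℕ) :
    ∑ i ∈ Finset.range (n + 1), (elapse a c).1 i = ∑ i ∈ Finset.range (n + 1), c.1 i - a := by
  rw [Finset.sum_range_succ', Finset.sum_range_succ' c.1]
  simp only [elapse, seqCons_succ, seqCons_zero, seqTail]
  ring

lemma RegularArrivals.dropFirst {c : Arrivals} (h : RegularArrivals c) :
    RegularArrivals (dropFirst c) where
  finite t := by
    refine ((h.finite (t + c.1 0)).preimage (f := Nat.succ) Nat.succ_injective.injOn).subset ?_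
    intro n hn
    have hn' : ∑ i ∈ Finset.range (n + 1), seqTail c.1 i ≤ t := hn
    rw [sum_seqTail] at hn'
    change ∑ i ∈ Finset.range (n + 2), c.1 i ≤ t + c.1 0
    linarith
  time_nonneg i := h.time_nonneg _
  size_nonneg i := h.size_nonneg _

lemma RegularArrivals.elapse {c : Arrivals} (h : RegularArrivals c) {a : ℝ} (ha : a ≤ c.1 0) :
    RegularArrivals (elapse a c) where
  finite t := by
    refine (h.finite (t + a)).subset fun n hn => ?_
    simp only [mem_ofPred_eq, sum_elapse] at hn ⊢
    linarith
  time_nonneg i := by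
    cases i with
    | zero => simpa [ThresholdDividends.elapse] using ha
    | succ i => exact h.time_nonneg (i + 1)
  size_nonneg i := h.size_nonneg _

lemma RegularArrivals.le_sum {c : Arrivals} (h : RegularArrivals c) (n : ℕ) :
    c.1 0 ≤ ∑ i ∈ Finset.range (n + 1), c.1 i :=
  Finset.single_le_sum (fun i _ => h.time_nonneg i) (Finset.mem_range.2 n.succ_pos)

lemma RegularArrivals.aggregate_eq_zero {c : Arrivals} (h : RegularArrivals c) {t : ℝ}
    (ht : t < c.1 0) : aggregate c.1 c.2 t = 0 := by
  have : {n : ℕ | ∑ i ∈ Finset.range (n + 1), c.1 i ≤ t} = ∅ := by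
    ext n
    simpa using ht.trans_le (h.le_sum n)
  simp [aggregate, arrivalCount, this]

lemma RegularArrivals.aggregate_nonneg {c : Arrivals} (h : RegularArrivals c) (t : ℝ) :
    0 ≤ aggregate c.1 c.2 t :=
  Finset.sum_nonneg fun i _ => h.size_nonneg i

/-- The arrivals up to `c.1 0 + t` are the first one and the successors of those counted for the
shifted sequence. Finiteness is essential: the `ncard` of an infinite set is `0`. -/
lemma RegularArrivals.aggregate_add {c : Arrivals} (h : RegularArrivals c) {t : ℝ} (ht : 0 ≤ t) :
    aggregate c.1 c.2 (c.1 0 + t)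
      = c.2 0 + aggregate (ThresholdDividends.dropFirst c).1 (ThresholdDividends.dropFirst c).2 t := by
  have hset : {n : ℕ | ∑ i ∈ Finset.range (n + 1), c.1 i ≤ c.1 0 + t}
      = insert 0 (Nat.succ '' {n : ℕ | ∑ i ∈ Finset.range (n + 1), seqTail c.1 i ≤ t}) := by
    ext n
    cases n with
    | zero => simpa using ht
    | succ n =>
      simp only [mem_ofPred_eq, sum_seqTail, mem_insert_iff, Nat.succ_ne_zero, mem_image,
        Nat.succ_eq_add_one, Nat.add_right_cancel_iff, exists_eq_right, false_or]
      constructor <;> intro h <;> linarith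
  have hcount : arrivalCount c.1 (c.1 0 + t) = arrivalCount (seqTail c.1) t + 1 := by
    unfold arrivalCount
    have hfin : {n : ℕ | ∑ i ∈ Finset.range (n + 1), seqTail c.1 i ≤ t}.Finite :=
      h.dropFirst.finite t
    rw [hset, ncard_insert_of_notMem (by simp) (hfin.image _),
      ncard_image_of_injective _ Nat.succ_injective]
  simp only [aggregate, ThresholdDividends.dropFirst]
  rw [hcount, Finset.sum_range_succ', add_comm]
  rfl

lemma aggregate_elapse (c : Arrivals) (a t : ℝ) :
    aggregate (elapse a c).1 (elapse a c).2 t = aggregate c.1 c.2 (a + t) := by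
  have : ∀ n, ∑ i ∈ Finset.range (n + 1), (elapse a c).1 i ≤ t
      ↔ ∑ i ∈ Finset.range (n + 1), c.1 i ≤ a + t := fun n => by
    rw [sum_elapse]; constructor <;> intro h <;> linarith
  simp only [aggregate, arrivalCount, this]
  rfl

lemma RegularArrivals.measurable_aggregate {c : Arrivals} (h : RegularArrivals c) :
    Measurable fun t => aggregate c.1 c.2 t := by
  have hmono : Monotone (arrivalCount c.1) := fun s t hst =>
    ncard_le_ncard (fun n hn => le_trans hn hst) (h.finite t)
  exact (measurable_from_nat (f := fun n => ∑ i ∈ Finset.range n, c.2 i)).comp hmono.measurable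

/-- The path `X` starts from `x`, moves by the premiums `p` and the claims `c`, and pays
dividends above the threshold. -/
def SurplusPath (d b x : ℝ) (c p : Arrivals) (X : ℝ → ℝ) : Prop :=
  ∀ t, 0 ≤ t → X t = x + aggregate p.1 p.2 t - aggregate c.1 c.2 t
    - ∫ s in (0 : ℝ)..t, dividendRate d b (X s)

/-- No measurability of `f` is needed. The times up to which `f` is integrable form an interval, on
which the primitive is monotone; beyond it the interval integral is `0` by convention. -/
lemma aemeasurable_primitive {f : ℝ → ℝ} (hf : ∀ s, 0 ≤ f s) :
    AEMeasurable (fun t => ∫ s in (0 : ℝ)..t, f s) (volume.restrict (Ici 0)) := by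
  set R : Set ℝ := {t | 0 ≤ t ∧ IntervalIntegrable f volume 0 t}
  have hR : R.OrdConnected := by
    refine ⟨fun s hs t ht u hu => ⟨hs.1.trans hu.1, ht.2.mono_set ?_⟩⟩
    rw [uIcc_of_le ht.1, uIcc_of_le (hs.1.trans hu.1)]
    exact Icc_subset_Icc le_rfl hu.2
  have hRm : MeasurableSet R := hR.measurableSet
  have hunion : Ici (0 : ℝ) = R ∪ (Ici 0 \ R) := by
    rw [union_sdiff_cancel]; exact fun t ht => ht.1
  rw [hunion, aemeasurable_union_iff]
  constructor
  · refine aemeasurable_restrict_of_monotoneOn hRm fun s hs t ht hst => ?_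
    refine intervalIntegral.integral_mono_interval le_rfl hs.1 hst ?_ ht.2
    exact Eventually.of_forall hf
  · refine (aemeasurable_const (b := (0 : ℝ))).congr ?_
    refine (ae_restrict_iff' (measurableSet_Ici.diff hRm)).2 (Eventually.of_forall fun t ht => ?_)
    exact (intervalIntegral.integral_undef fun h => ht.2 ⟨ht.1, h⟩).symm

/-- The equation of the path itself makes it measurable in time: its right-hand side consists of
step functions and a primitive of a nonnegative function. -/
lemma SurplusPath.aemeasurable {d b x : ℝ} {c p : Arrivals} {X : ℝ → ℝ} (hd : 0 ≤ d)
    (h : SurplusPath d b x c p X) (hc : RegularArrivals c) (hp : RegularArrivals p) :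
    AEMeasurable X (volume.restrict (Ici 0)) := by
  have h1 : AEMeasurable (fun t => x + aggregate p.1 p.2 t - aggregate c.1 c.2 t
      - ∫ s in (0 : ℝ)..t, dividendRate d b (X s)) (volume.restrict (Ici 0)) :=
    (((hp.measurable_aggregate.const_add x).sub hc.measurable_aggregate).aemeasurable).sub
      (aemeasurable_primitive fun s => dividendRate_nonneg hd b _)
  refine h1.congr ?_
  exact (ae_restrict_iff' measurableSet_Ici).2 (Eventually.of_forall fun t ht => (h t ht).symm)

lemma SurplusPath.intervalIntegrable {d b x : ℝ} {c p : Arrivals} {X : ℝ → ℝ} (hd : 0 ≤ d)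
    (h : SurplusPath d b x c p X) (hc : RegularArrivals c) (hp : RegularArrivals p) {s t : ℝ}
    (hs : 0 ≤ s) (ht : 0 ≤ t) :
    IntervalIntegrable (fun s => dividendRate d b (X s)) volume s t := by
  have h0 : ∀ t, 0 ≤ t → IntervalIntegrable (fun s => dividendRate d b (X s)) volume 0 t := by
    intro t ht
    rw [intervalIntegrable_iff, uIoc_of_le ht]
    refine IntegrableOn.of_bound (C := d) (by simp) ?_ ?_
    · have h1 := (measurable_dividendRate d b).comp_aemeasurable (h.aemeasurable hd hc hp)
      exact (h1.mono_measure (Measure.restrict_mono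
        (Ioc_subset_Icc_self.trans Icc_subset_Ici_self) le_rfl)).aestronglyMeasurable
    · refine Eventually.of_forall fun s => ?_
      rw [Real.norm_of_nonneg (dividendRate_nonneg hd b _)]
      exact dividendRate_le hd b _
  exact (h0 s hs).symm.trans (h0 t ht)

lemma integral_step {f : ℝ → ℝ} {d s t : ℝ} (hs : 0 ≤ s) (ht : 0 ≤ t)
    (h1 : ∀ r ∈ Icc 0 t, r < s → f r = d) (h2 : ∀ r ∈ Icc 0 t, s < r → f r = 0) :
    ∫ r in (0 : ℝ)..t, f r = d * min t s := by
  have hae : ∫ r in (0 : ℝ)..t, f r = ∫ r in (0 : ℝ)..t, (Iio s).indicator (fun _ => d) r := by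
    refine intervalIntegral.integral_congr_ae ?_
    have : ∀ᵐ r : ℝ, r ≠ s := by simp [ae_iff]
    filter_upwards [this] with r hr hr'
    rw [uIoc_of_le ht] at hr'
    rcases lt_or_gt_of_ne hr with h | h
    · rw [h1 r (Ioc_subset_Icc_self hr') h, indicator_of_mem (by exact h)]
    · rw [h2 r (Ioc_subset_Icc_self hr') h, indicator_of_notMem (by simpa using h.le)]
  rw [hae, intervalIntegral.integral_of_le ht, setIntegral_indicator measurableSet_Iio,
    setIntegral_const, smul_eq_mul, mul_comm]
  congr 1
  have h3 : (Ioc 0 t ∩ Iio s : Set ℝ) =ᵐ[volume] Ioc 0 (min t s) := by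
    have : (Ioc 0 t ∩ Iio s : Set ℝ) =ᵐ[volume] (Ioc 0 t ∩ Iic s : Set ℝ) :=
      (ae_eq_refl _).inter Iio_ae_eq_Iic
    rwa [Ioc_inter_Iic] at this
  rw [measureReal_congr h3]
  rw [Real.volume_real_Ioc_of_le (le_min ht hs), sub_zero]

lemma flow_of_le {d b x t : ℝ} (hd : 0 ≤ d) (ht : 0 ≤ t) (hx : x ≤ b) : flow d b x t = x := by
  rw [flow, min_eq_left hx, max_eq_left]
  nlinarith [mul_nonneg hd ht]

lemma flow_of_gt {d b x t : ℝ} (hx : b ≤ x) : flow d b x t = max b (x - d * t) := by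
  rw [flow, min_eq_right hx]

lemma flow_nonneg {d b x : ℝ} (hb : 0 ≤ b) (hx : 0 ≤ x) (t : ℝ) : 0 ≤ flow d b x t :=
  (le_min hx hb).trans (le_max_left _ _)

lemma sub_mul_min_div {d b x t : ℝ} (hd : 0 < d) (hx : b ≤ x) :
    x - d * min t ((x - b) / d) = flow d b x t := by
  rw [flow_of_gt hx, mul_min_of_nonneg _ _ hd.le, mul_div_cancel₀ _ hd.ne']
  rcases le_total (d * t) (x - b) with h | h
  · rw [min_eq_left h, max_eq_right (by linarith)]
  · rw [min_eq_right h, max_eq_left (by linarith)]; ring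

lemma integral_dividendRate_flow {d b x t : ℝ} (hd : 0 < d) (ht : 0 ≤ t) :
    ∫ s in (0 : ℝ)..t, dividendRate d b (flow d b x s) = x - flow d b x t := by
  rcases le_or_gt x b with hx | hx
  · rw [flow_of_le hd.le ht hx, sub_self]
    refine intervalIntegral.integral_zero_ae (Eventually.of_forall fun s hs => ?_)
    rw [uIoc_of_le ht] at hs
    rw [flow_of_le hd.le hs.1.le hx, dividendRate, if_neg hx.not_gt]
  · rw [integral_step (d := d) (s := (x - b) / d) (div_nonneg (by linarith) hd.le) ht,
      ← sub_mul_min_div hd hx.le]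
    · ring
    · intro r _ hr
      rw [lt_div_iff₀ hd] at hr
      rw [flow_of_gt hx.le, dividendRate, if_pos]
      exact lt_max_of_lt_right (by linarith)
    · intro r _ hr
      rw [div_lt_iff₀ hd] at hr
      rw [flow_of_gt hx.le, dividendRate, if_neg]
      rw [max_eq_left (by linarith)]
      exact lt_irrefl _

/-- The rate jumps at `b`, so monotonicity replaces a Lipschitz argument. From `x ≤ b` the path
never exceeds `b` and nothing is paid. From `x > b`, before time `(x - b) / d` less than `x - b` has
been paid, so the path is still above `b`; by that time exactly `x - b` has been paid, and the path
cannot exceed `b` again. -/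
lemma eq_flow {d b x t : ℝ} {X : ℝ → ℝ} (hd : 0 < d) (ht : 0 ≤ t)
    (hX : ∀ s ∈ Icc 0 t, X s = x - ∫ r in (0 : ℝ)..s, dividendRate d b (X r))
    (hint : ∀ r s, 0 ≤ r → 0 ≤ s →
      IntervalIntegrable (fun s => dividendRate d b (X s)) volume r s) :
    X t = flow d b x t := by
  have hnn : ∀ r s, r ≤ s → 0 ≤ ∫ r in r..s, dividendRate d b (X r) := fun r s hs =>
    intervalIntegral.integral_nonneg hs fun r _ => dividendRate_nonneg hd.le b _
  rcases le_or_gt x b with hx | hx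
  · rw [flow_of_le hd.le ht hx, hX t ⟨ht, le_rfl⟩, sub_eq_self]
    refine intervalIntegral.integral_zero_ae (Eventually.of_forall fun s hs => ?_)
    rw [uIoc_of_le ht] at hs
    rw [dividendRate, if_neg]
    rw [hX s (Ioc_subset_Icc_self hs), not_lt]
    linarith [hnn 0 s hs.1.le]
  · set s₀ := (x - b) / d with hs₀
    have hs₀' : d * s₀ = x - b := mul_div_cancel₀ _ hd.ne'
    have hs₀0 : 0 ≤ s₀ := div_nonneg (by linarith) hd.le
    have hbelow : ∀ r ∈ Icc 0 t, r < s₀ → dividendRate d b (X r) = d := by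
      intro r hr hrs
      have h1 : ∫ u in (0 : ℝ)..r, dividendRate d b (X u) ≤ d * r := by
        have := intervalIntegral.integral_mono_on hr.1 (hint 0 r le_rfl hr.1)
          (intervalIntegrable_const (c := d)) fun u _ => dividendRate_le hd.le b (X u)
        simpa [mul_comm] using this
      rw [dividendRate, if_pos]
      rw [hX r hr]
      have := mul_lt_mul_of_pos_left hrs hd
      linarith
    have habove : ∀ r ∈ Icc 0 t, s₀ < r → dividendRate d b (X r) = 0 := by
      intro r hr hrs
      have h1 : ∫ u in (0 : ℝ)..s₀, dividendRate d b (X u) = d * s₀ := by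
        rw [integral_step hs₀0 hs₀0 (fun u hu hus => hbelow u ⟨hu.1, hu.2.trans
          (hrs.le.trans hr.2)⟩ hus) (fun u hu hus => absurd hus hu.2.not_gt), min_self]
      have h2 := intervalIntegral.integral_add_adjacent_intervals (hint 0 s₀ le_rfl hs₀0)
        (hint s₀ r hs₀0 hr.1)
      rw [dividendRate, if_neg]
      rw [hX r hr, not_lt]
      linarith [hnn s₀ r hrs.le]
    rw [hX t ⟨ht, le_rfl⟩, integral_step hs₀0 ht hbelow habove, sub_mul_min_div hd hx.le]

section Path

variable {d b x : ℝ} {c p : Arrivals} {X : ℝ → ℝ}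

lemma SurplusPath.eq_flow (hd : 0 < d) (h : SurplusPath d b x c p X) (hc : RegularArrivals c)
    (hp : RegularArrivals p) {t : ℝ} (ht : 0 ≤ t) (htc : t < c.1 0) (htp : t < p.1 0) :
    X t = flow d b x t := by
  refine ThresholdDividends.eq_flow hd ht (fun s hs => ?_)
    (fun r s hr hs => h.intervalIntegrable hd.le hc hp hr hs)
  rw [h s hs.1, hc.aggregate_eq_zero (hs.2.trans_lt htc), hp.aggregate_eq_zero (hs.2.trans_lt htp)]
  ring

lemma SurplusPath.integral_add (hd : 0 < d) (h : SurplusPath d b x c p X)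
    (hc : RegularArrivals c) (hp : RegularArrivals p) {a t : ℝ} (ha : 0 ≤ a) (hac : a ≤ c.1 0)
    (hap : a ≤ p.1 0) (ht : 0 ≤ t) :
    ∫ s in (0 : ℝ)..(a + t), dividendRate d b (X s)
      = x - flow d b x a + ∫ s in (0 : ℝ)..t, dividendRate d b (X (a + s)) := by
  rw [← intervalIntegral.integral_add_adjacent_intervals
    (h.intervalIntegrable hd.le hc hp le_rfl ha)
    (h.intervalIntegrable hd.le hc hp ha (add_nonneg ha ht)),
    ← integral_dividendRate_flow hd ha]
  congr 1
  · refine intervalIntegral.integral_congr_ae ?_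
    -- Time `a` is left out because the first arrival may occur there, and the path then need not
    -- equal the flow.
    have : ∀ᵐ r : ℝ, r ≠ a := by simp [ae_iff]
    filter_upwards [this] with r hr hr'
    rw [uIoc_of_le ha] at hr'
    have hra := lt_of_le_of_ne hr'.2 hr
    rw [h.eq_flow hd hc hp hr'.1.le (hra.trans_le hac) (hra.trans_le hap)]
  · rw [intervalIntegral.integral_comp_add_left (fun s => dividendRate d b (X s)), add_zero]

lemma SurplusPath.claim (hd : 0 < d) (h : SurplusPath d b x c p X) (hc : RegularArrivals c)
    (hp : RegularArrivals p) (hcp : c.1 0 ≤ p.1 0) :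
    SurplusPath d b (flow d b x (c.1 0) - c.2 0) (dropFirst c) (elapse (c.1 0) p)
      (fun t => X (c.1 0 + t)) := by
  intro t ht
  have ha := hc.time_nonneg 0
  beta_reduce
  rw [h _ (add_nonneg ha ht), h.integral_add hd hc hp ha le_rfl hcp ht, hc.aggregate_add ht,
    aggregate_elapse]
  ring

lemma SurplusPath.premium (hd : 0 < d) (h : SurplusPath d b x c p X) (hc : RegularArrivals c)
    (hp : RegularArrivals p) (hcp : p.1 0 ≤ c.1 0) :
    SurplusPath d b (flow d b x (p.1 0) + p.2 0) (elapse (p.1 0) c) (dropFirst p)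
      (fun t => X (p.1 0 + t)) := by
  intro t ht
  have ha := hp.time_nonneg 0
  beta_reduce
  rw [h _ (add_nonneg ha ht), h.integral_add hd hc hp ha hcp le_rfl ht, hp.aggregate_add ht,
    aggregate_elapse]
  ring

end Path

/-! ### The value of a path and its recursion -/

/-- The discounted dividends paid along a path as long as it is nonnegative. -/
noncomputable def pathValue (δ d b : ℝ) (X : ℝ → ℝ) : ℝ≥0∞ :=
  ∫⁻ t in Ici 0, {t : ℝ | ∀ s ∈ Icc 0 t, 0 ≤ X s}.indicator
    (fun t => ENNReal.ofReal (Real.exp (-(δ * t)) * dividendRate d b (X t))) t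

lemma lintegral_exp_neg {δ : ℝ} (hδ : 0 < δ) :
    ∫⁻ t in Ioi (0 : ℝ), ENNReal.ofReal (Real.exp (-(δ * t))) = ENNReal.ofReal (1 / δ) := by
  have h := integral_exp_mul_Ioi (a := -δ) (by linarith) 0
  have hi : IntegrableOn (fun t : ℝ => Real.exp (-δ * t)) (Ioi 0) :=
    exp_neg_integrableOn_Ioi 0 hδ
  rw [← ofReal_integral_eq_lintegral_ofReal (by simpa [IntegrableOn] using hi)
    (Eventually.of_forall fun t => (Real.exp_pos _).le)]
  congr 1
  simpa [neg_div_neg_eq, neg_mul] using h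

lemma pathValue_le {δ d b : ℝ} (hd : 0 ≤ d) (hδ : 0 < δ) (X : ℝ → ℝ) :
    pathValue δ d b X ≤ ENNReal.ofReal (d / δ) := by
  calc pathValue δ d b X
      ≤ ∫⁻ t in Ici 0, ENNReal.ofReal (Real.exp (-(δ * t))) * ENNReal.ofReal d := by
        refine lintegral_mono fun t => (indicator_le_self _ _ _).trans ?_
        rw [← ENNReal.ofReal_mul (Real.exp_pos _).le]
        exact ENNReal.ofReal_le_ofReal (mul_le_mul_of_nonneg_left (dividendRate_le hd b _)
          (Real.exp_pos _).le)
    _ = ENNReal.ofReal (d / δ) := by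
        rw [lintegral_mul_const' _ _ ENNReal.ofReal_ne_top,
          ← setLIntegral_congr (Ioi_ae_eq_Ici (a := (0 : ℝ))), lintegral_exp_neg hδ,
          ← ENNReal.ofReal_mul (by positivity)]
        congr 1; ring

lemma pathValue_of_neg {δ d b : ℝ} {X : ℝ → ℝ} (hX : X 0 < 0) : pathValue δ d b X = 0 := by
  unfold pathValue
  rw [setLIntegral_congr_fun (g := fun _ => 0) measurableSet_Ici, lintegral_zero]
  intro t ht
  refine indicator_of_notMem (fun h => ?_) _
  exact hX.not_ge (h 0 ⟨le_rfl, ht⟩)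

/-- Since the path is nonnegative before `a`, survival up to `a + t` is survival of the shifted path
up to `t`. -/
lemma pathValue_split {δ d b : ℝ} {X : ℝ → ℝ} {a : ℝ} (ha : 0 ≤ a)
    (hX : ∀ s ∈ Ico 0 a, 0 ≤ X s) :
    pathValue δ d b X
      = (∫⁻ t in Ioi 0, if t < a then
          ENNReal.ofReal (Real.exp (-(δ * t)) * dividendRate d b (X t)) else 0)
        + ENNReal.ofReal (Real.exp (-(δ * a))) * pathValue δ d b (fun t => X (a + t)) := by
  unfold pathValue
  have hu : (volume : Measure ℝ).restrict (Ici 0) = volume.restrict (Ico 0 a ∪ Ici a) := by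
    rw [Ico_union_Ici_eq_Ici ha]
  conv_lhs => rw [hu]
  rw [lintegral_union measurableSet_Ici
    (disjoint_left.2 fun t ht ht' => ht.2.not_ge ht')]
  congr 1
  · rw [setLIntegral_congr (Ioi_ae_eq_Ici (a := (0 : ℝ))), ← lintegral_indicator measurableSet_Ico,
      ← lintegral_indicator measurableSet_Ici]
    refine lintegral_congr fun t => ?_
    by_cases h0 : 0 ≤ t
    · by_cases hta : t < a
      · rw [indicator_of_mem (show t ∈ Ico 0 a from ⟨h0, hta⟩), indicator_of_mem (show t ∈ Ici 0 from h0),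
          if_pos hta, indicator_of_mem]
        exact fun s hs => hX s ⟨hs.1, hs.2.trans_lt hta⟩
      · rw [indicator_of_notMem (fun h => hta h.2), indicator_of_mem (show t ∈ Ici 0 from h0),
          if_neg hta]
    · rw [indicator_of_notMem (fun h => h0 h.1), indicator_of_notMem (show t ∉ Ici 0 from h0)]
  · rw [← lintegral_const_mul' _ _ ENNReal.ofReal_ne_top, ← lintegral_indicator measurableSet_Ici,
      ← lintegral_indicator measurableSet_Ici, ← lintegral_add_left_eq_self _ a]
    refine lintegral_congr fun t => ?_
    by_cases h0 : 0 ≤ t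
    · rw [indicator_of_mem (show a + t ∈ Ici a by simpa using h0),
        indicator_of_mem (show t ∈ Ici 0 from h0)]
      have hiff : a + t ∈ {t : ℝ | ∀ s ∈ Icc 0 t, 0 ≤ X s}
          ↔ t ∈ {t : ℝ | ∀ s ∈ Icc 0 t, 0 ≤ X (a + s)} := by
        constructor
        · intro h s hs
          exact h (a + s) ⟨add_nonneg ha hs.1, by linarith [hs.2]⟩
        · intro h s hs
          rcases lt_or_ge s a with hsa | hsa
          · exact hX s ⟨hs.1, hsa⟩
          · have := h (s - a) ⟨by linarith, by linarith [hs.2]⟩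
            simpa using this
      by_cases hm : a + t ∈ {t : ℝ | ∀ s ∈ Icc 0 t, 0 ≤ X s}
      · rw [indicator_of_mem hm, indicator_of_mem (hiff.1 hm),
          ← ENNReal.ofReal_mul (Real.exp_pos _).le, ← mul_assoc, ← Real.exp_add]
        congr 3; ring
      · rw [indicator_of_notMem hm, indicator_of_notMem (fun h => hm (hiff.2 h)), mul_zero]
    · rw [indicator_of_notMem (show a + t ∉ Ici a by simpa using h0),
        indicator_of_notMem (show t ∉ Ici 0 from h0)]

/-- A path with its data; if it starts below `0` then there is no premium at time `0`. -/
structure AdmissiblePath (d b : ℝ) (q : ℝ × Arrivals × Arrivals) (X : ℝ → ℝ) : Prop where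
  path : SurplusPath d b q.1 q.2.1 q.2.2 X
  claims : RegularArrivals q.2.1
  premiums : RegularArrivals q.2.2
  pos_of_neg : q.1 < 0 → 0 < q.2.2.1 0

/-- With no premium at time `0`, a negative start cannot be repaired at once, and claims at time `0`
only lower the surplus. Ruin is immediate. -/
lemma AdmissiblePath.pathValue_of_neg {δ d b : ℝ} {q : ℝ × Arrivals × Arrivals} {X : ℝ → ℝ}
    (h : AdmissiblePath d b q X) (hq : q.1 < 0) : pathValue δ d b X = 0 := by
  refine ThresholdDividends.pathValue_of_neg ?_
  rw [h.path 0 le_rfl, h.premiums.aggregate_eq_zero (h.pos_of_neg hq)]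
  have := h.claims.aggregate_nonneg 0
  simp only [intervalIntegral.integral_same]
  linarith

/-- The value of a path satisfies the same recursion as `renewalStep`. -/
lemma AdmissiblePath.exists_step {δ d b : ℝ} (hd : 0 < d) (hb : 0 ≤ b)
    {q : ℝ × Arrivals × Arrivals} {X : ℝ → ℝ} (h : AdmissiblePath d b q X) :
    ∃ (q' : ℝ × Arrivals × Arrivals) (X' : ℝ → ℝ) (g k : ℝ≥0∞), AdmissiblePath d b q' X' ∧
      (∀ F : ℝ × Arrivals × Arrivals → ℝ≥0∞, renewalStep δ d b F q = g + k * F q') ∧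
      pathValue δ d b X = g + k * pathValue δ d b X' := by
  rcases lt_or_ge q.1 0 with hq | hq
  -- After ruin both sides are `0`; with weight `k = 0` the continuation is irrelevant.
  · exact ⟨q, X, 0, 0, h, fun F => by simp [renewalStep, hq], by simp [h.pathValue_of_neg hq]⟩
  obtain ⟨x, c, p⟩ := q
  obtain ⟨hX, hc, hp, -⟩ := h
  simp only at hX hc hp hq
  let g : ℝ≥0∞ := ∫⁻ t in Ioi 0, if t < c.1 0 ∧ t < p.1 0 then
        ENNReal.ofReal (Real.exp (-(δ * t)) * dividendRate d b (flow d b x t)) else 0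
  have hflow : ∀ t, 0 ≤ t → t < c.1 0 → t < p.1 0 → X t = flow d b x t := fun t ht htc htp =>
    hX.eq_flow hd hc hp ht htc htp
  have hcongr : ∀ a, (∀ t, t < a ↔ t < c.1 0 ∧ t < p.1 0) →
      (∫⁻ t in Ioi 0, if t < a then
        ENNReal.ofReal (Real.exp (-(δ * t)) * dividendRate d b (X t)) else 0)
      = g := by
    intro a ha
    refine setLIntegral_congr_fun measurableSet_Ioi fun t ht => ?_
    by_cases hta : t < a
    · have := (ha t).1 hta
      rw [if_pos hta, if_pos this, hflow t (le_of_lt ht) this.1 this.2]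
    · rw [if_neg hta, if_neg (fun h => hta ((ha t).2 h))]
  have hnonneg : ∀ a, (∀ t, t < a ↔ t < c.1 0 ∧ t < p.1 0) → ∀ s ∈ Ico 0 a, 0 ≤ X s := by
    intro a ha s hs
    have := (ha s).1 hs.2
    rw [hflow s hs.1 this.1 this.2]
    exact flow_nonneg hb hq s
  rcases lt_or_ge (c.1 0) (p.1 0) with hcp | hcp
  · have ha : ∀ t, t < c.1 0 ↔ t < c.1 0 ∧ t < p.1 0 := fun t =>
      ⟨fun h => ⟨h, h.trans hcp⟩, fun h => h.1⟩
    refine ⟨(flow d b x (c.1 0) - c.2 0, dropFirst c, elapse (c.1 0) p), fun t => X (c.1 0 + t),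
      g, ENNReal.ofReal (Real.exp (-(δ * c.1 0))), ⟨hX.claim hd hc hp hcp.le, hc.dropFirst, hp.elapse hcp.le, fun _ => ?_⟩,
      fun F => ?_, ?_⟩
    rotate_left 2
    · rw [pathValue_split (hc.time_nonneg 0) (hnonneg _ ha), hcongr _ ha]
    -- The claim comes strictly first, so the residual time to the next premium is positive.
    · simpa [elapse] using hcp
    · simp only [renewalStep]
      rw [if_neg hq.not_gt, if_pos hcp]
  · have ha : ∀ t, t < p.1 0 ↔ t < c.1 0 ∧ t < p.1 0 := fun t =>
      ⟨fun h => ⟨h.trans_le hcp, h⟩, fun h => h.2⟩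
    refine ⟨(flow d b x (p.1 0) + p.2 0, elapse (p.1 0) c, dropFirst p), fun t => X (p.1 0 + t),
      g, ENNReal.ofReal (Real.exp (-(δ * p.1 0))), ⟨hX.premium hd hc hp hcp, hc.elapse hcp, hp.dropFirst, fun h => ?_⟩,
      fun F => ?_, ?_⟩
    rotate_left 2
    · rw [pathValue_split (hp.time_nonneg 0) (hnonneg _ ha), hcongr _ ha]
    -- Just after a premium the surplus is nonnegative, so the condition for a negative start is
    -- void.
    · exact absurd h (add_nonneg (flow_nonneg hb hq _) (hp.size_nonneg 0)).not_gt
    · simp only [renewalStep]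
      rw [if_neg hq.not_gt, if_neg hcp.not_gt]

/-- Value and iterate obey the same affine recursion with nonnegative coefficients, so a comparison
for the continuation carries over to the path. The induction starts from `0` here and from the a
priori bound `d / δ` in the next lemma. -/
lemma AdmissiblePath.iterate_renewalStep_zero_le {δ d b : ℝ} (hd : 0 < d) (hb : 0 ≤ b) (n : ℕ)
    {q : ℝ × Arrivals × Arrivals} {X : ℝ → ℝ} (h : AdmissiblePath d b q X) :
    (renewalStep δ d b)^[n] (fun _ => 0) q ≤ pathValue δ d b X := by
  induction n generalizing q X with
  | zero => simp
  | succ n ih =>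
    obtain ⟨q', X', g, k, h', hF, hX⟩ := h.exists_step (δ := δ) hd hb
    rw [Function.iterate_succ_apply', hF, hX]
    gcongr
    exact ih h'

lemma AdmissiblePath.le_iterate_renewalStep {δ d b : ℝ} (hd : 0 < d) (hb : 0 ≤ b) (hδ : 0 < δ)
    (n : ℕ) {q : ℝ × Arrivals × Arrivals} {X : ℝ → ℝ} (h : AdmissiblePath d b q X) :
    pathValue δ d b X ≤ (renewalStep δ d b)^[n] (fun _ => ENNReal.ofReal (d / δ)) q := by
  induction n generalizing q X with
  | zero => exact pathValue_le hd.le hδ X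
  | succ n ih =>
    obtain ⟨q', X', g, k, h', hF, hX⟩ := h.exists_step (δ := δ) hd hb
    rw [Function.iterate_succ_apply', hF, hX]
    gcongr
    exact ih h'

/-! ### Integrals against exponential densities -/

lemma integral_expMeasure {r : ℝ} (hr : 0 < r) (f : ℝ → ℝ) :
    ∫ x, f x ∂expMeasure r = ∫ x in Ioi 0, r * Real.exp (-(r * x)) * f x := by
  have h0 : expMeasure r = volume.withDensity (fun x => ENNReal.ofReal (exponentialPDFReal r x)) :=
    rfl
  rw [h0, integral_withDensity_eq_integral_toReal_smul
    (measurable_exponentialPDFReal r).ennreal_ofReal (by simp),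
    setIntegral_congr_set (Ioi_ae_eq_Ici (a := (0 : ℝ))), ← integral_indicator measurableSet_Ici]
  refine integral_congr_ae (Eventually.of_forall fun x => ?_)
  beta_reduce
  rw [ENNReal.toReal_ofReal (exponentialPDFReal_nonneg hr x)]
  by_cases hx : 0 ≤ x
  · rw [indicator_of_mem (show x ∈ Ici 0 from hx), exponentialPDFReal, gammaPDFReal, if_pos hx]
    simp
  · rw [indicator_of_notMem (show x ∉ Ici 0 from hx), exponentialPDFReal, gammaPDFReal, if_neg hx]
    simp

lemma integrableOn_exp_mul {r s M : ℝ} (hr : 0 < r) {f : ℝ → ℝ} (hf : Measurable f)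
    (hM : ∀ x, |f x| ≤ M) : IntegrableOn (fun x => Real.exp (-(r * x)) * f x) (Ioi s) := by
  have h1 : IntegrableOn (fun x => Real.exp (-(r * x))) (Ioi s) := by
    simpa using exp_neg_integrableOn_Ioi s hr
  exact Integrable.mul_bdd (c := M) h1 hf.aestronglyMeasurable (Eventually.of_forall hM)

lemma integral_exp_neg_mul_Ioi {r : ℝ} (hr : 0 < r) (s : ℝ) :
    ∫ x in Ioi s, Real.exp (-(r * x)) = Real.exp (-(r * s)) / r := by
  have h := integral_exp_mul_Ioi (a := -r) (by linarith) s
  simp only [neg_mul] at h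
  rw [h, neg_div_neg_eq]

/-- The integral of an exponential function against an exponential density. -/
lemma integral_expDensity_mul_exp {r k : ℝ} (hk : r - k ≠ 0) (α s t : ℝ) :
    ∫ y in s..t, r * Real.exp (-(r * y)) * Real.exp (k * (α + y))
      = r / (r - k) * (Real.exp (-(r * s)) * Real.exp (k * (α + s))
        - Real.exp (-(r * t)) * Real.exp (k * (α + t))) := by
  have hderiv : ∀ y ∈ uIcc s t, HasDerivAt
      (fun y => -(r / (r - k)) * (Real.exp (-(r * y)) * Real.exp (k * (α + y))))
      (r * Real.exp (-(r * y)) * Real.exp (k * (α + y))) y := by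
    intro y _
    have h1 : HasDerivAt (fun y => Real.exp (-(r * y))) (Real.exp (-(r * y)) * (-(r * 1))) y :=
      (((hasDerivAt_id y).const_mul r).neg).exp
    have h2 : HasDerivAt (fun y => Real.exp (k * (α + y))) (Real.exp (k * (α + y)) * (k * 1)) y :=
      (((hasDerivAt_id y).const_add α).const_mul k).exp
    have h3 : r / (r - k) * (r - k) = r := div_mul_cancel₀ _ hk
    refine ((h1.mul h2).const_mul (-(r / (r - k)))).congr_deriv ?_
    linear_combination Real.exp (-(r * y)) * Real.exp (k * (α + y)) * h3
  rw [intervalIntegral.integral_eq_sub_of_hasDerivAt hderiv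
    (Continuous.intervalIntegrable (by fun_prop) _ _)]
  ring

lemma integral_expDensity_mul_exp_Ioi {r k : ℝ} (hk : k < r) (α s : ℝ) :
    ∫ y in Ioi s, r * Real.exp (-(r * y)) * Real.exp (k * (α + y))
      = r / (r - k) * (Real.exp (-(r * s)) * Real.exp (k * (α + s))) := by
  have h : ∀ y, r * Real.exp (-(r * y)) * Real.exp (k * (α + y))
      = r * Real.exp (k * α) * Real.exp (-((r - k) * y)) := fun y => by
    rw [mul_assoc, mul_assoc, ← Real.exp_add, ← Real.exp_add]
    congr 2; ring
  simp_rw [h]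
  rw [integral_const_mul, integral_exp_neg_mul_Ioi (sub_pos.2 hk), ← Real.exp_add, mul_div_assoc',
    mul_assoc, ← Real.exp_add]
  rw [div_mul_eq_mul_div]
  congr 3; ring

lemma integrableOn_expDensity_mul_exp_Ioi {r k : ℝ} (hk : k < r) (α s : ℝ) :
    IntegrableOn (fun y => r * Real.exp (-(r * y)) * Real.exp (k * (α + y))) (Ioi s) := by
  have h : ∀ y, r * Real.exp (-(r * y)) * Real.exp (k * (α + y))
      = r * Real.exp (k * α) * Real.exp (-((r - k) * y)) := fun y => by
    rw [mul_assoc, mul_assoc, ← Real.exp_add, ← Real.exp_add]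
    congr 2; ring
  simp_rw [h]
  have := exp_neg_integrableOn_Ioi s (sub_pos.2 hk)
  simp only [neg_mul] at this
  exact this.const_mul _

/-! ### The candidate and its integral equation -/

/-- Four constants that satisfy the linear system, with `q` in place of `d / δ`. The numbers `a i`
and `c i` are the values at `z i` of the Laplace transforms of claims and premiums. -/
structure SystemSolution (lam lamb mu mub b d δ q : ℝ) (C z a c : Fin 4 → ℝ) : Prop where
  claim_inv : ∀ i, a i * (1 + mu * z i) = 1
  premium_inv : ∀ i, c i * (1 - mub * z i) = 1
  premium_lt : ∀ i, mub * z i < 1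
  neg_two : z 2 < 0
  neg_three : z 3 < 0
  char_zero : lam * a 0 + lamb * c 0 = lam + lamb + δ
  char_one : lam * a 1 + lamb * c 1 = lam + lamb + δ
  char_two : lam * a 2 + lamb * c 2 = lam + lamb + δ + d * z 2
  char_three : lam * a 3 + lamb * c 3 = lam + lamb + δ + d * z 3
  claims_zero : C 0 * a 0 + C 1 * a 1 = 0
  premiums : C 0 * c 0 * Real.exp (z 0 * b) + C 1 * c 1 * Real.exp (z 1 * b)
    = C 2 * c 2 * Real.exp (z 2 * b) + C 3 * c 3 * Real.exp (z 3 * b) + q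
  continuity : C 0 * Real.exp (z 0 * b) + C 1 * Real.exp (z 1 * b)
    = C 2 * Real.exp (z 2 * b) + C 3 * Real.exp (z 3 * b) + q
  claims : C 0 * a 0 * Real.exp (z 0 * b) + C 1 * a 1 * Real.exp (z 1 * b)
    = C 2 * a 2 * Real.exp (z 2 * b) + C 3 * a 3 * Real.exp (z 3 * b) + q

noncomputable def lowValue (C z : Fin 4 → ℝ) (x : ℝ) : ℝ :=
  C 0 * Real.exp (z 0 * x) + C 1 * Real.exp (z 1 * x)

noncomputable def highValue (q : ℝ) (C z : Fin 4 → ℝ) (x : ℝ) : ℝ :=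
  C 2 * Real.exp (z 2 * x) + C 3 * Real.exp (z 3 * x) + q

/-- The candidate for the expected discounted dividends. -/
noncomputable def candidate (b q : ℝ) (C z : Fin 4 → ℝ) (x : ℝ) : ℝ :=
  if x < 0 then 0 else if x ≤ b then lowValue C z x else highValue q C z x

/-- The value of `(λ + λ̄ + δ) w + d w'`, where `w'` counts above the threshold only. -/
noncomputable def candidateRate (A b d q : ℝ) (C z : Fin 4 → ℝ) (x : ℝ) : ℝ :=
  A * candidate b q C z x
    + if b < x then d * (C 2 * z 2 * Real.exp (z 2 * x) + C 3 * z 3 * Real.exp (z 3 * x)) else 0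

lemma measurable_candidate (b q : ℝ) (C z : Fin 4 → ℝ) : Measurable (candidate b q C z) := by
  unfold candidate lowValue highValue
  exact Measurable.ite measurableSet_Iio measurable_const
    (Measurable.ite measurableSet_Iic (by fun_prop) (by fun_prop))

lemma measurable_candidateRate (A b d q : ℝ) (C z : Fin 4 → ℝ) :
    Measurable (candidateRate A b d q C z) := by
  unfold candidateRate
  exact ((measurable_candidate b q C z).const_mul A).add
    (Measurable.ite measurableSet_Ioi (by fun_prop) measurable_const)

lemma abs_mul_exp_le {C z x : ℝ} (hz : z ≤ 0) (hx : 0 ≤ x) : |C * Real.exp (z * x)| ≤ |C| := by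
  rw [abs_mul, Real.abs_exp]
  exact mul_le_of_le_one_right (abs_nonneg _)
    (Real.exp_le_one_iff.2 (mul_nonpos_of_nonpos_of_nonneg hz hx))

lemma abs_mul_exp_le' {C z x b : ℝ} (hx : 0 ≤ x) (hxb : x ≤ b) :
    |C * Real.exp (z * x)| ≤ |C| * Real.exp (|z| * b) := by
  rw [abs_mul, Real.abs_exp]
  gcongr
  exact le_abs_self z

lemma exists_candidate_bound {b q : ℝ} {C z : Fin 4 → ℝ} (h2 : z 2 < 0)
    (h3 : z 3 < 0) : ∃ M, ∀ x, |candidate b q C z x| ≤ M := by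
  refine ⟨|C 0| * Real.exp (|z 0| * b) + |C 1| * Real.exp (|z 1| * b) + (|C 2| + |C 3| + |q|),
    fun x => ?_⟩
  unfold candidate
  split_ifs with hx hxb
  · rw [abs_zero]; positivity
  · have h := abs_add_le (C 0 * Real.exp (z 0 * x)) (C 1 * Real.exp (z 1 * x))
    have h0 := abs_mul_exp_le' (C := C 0) (z := z 0) (not_lt.1 hx) hxb
    have h1 := abs_mul_exp_le' (C := C 1) (z := z 1) (not_lt.1 hx) hxb
    have : 0 ≤ |C 2| + |C 3| + |q| := by positivity
    unfold lowValue
    linarith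
  · have h := abs_add_three (C 2 * Real.exp (z 2 * x)) (C 3 * Real.exp (z 3 * x)) q
    have h0 := abs_mul_exp_le (C := C 2) h2.le (not_lt.1 hx)
    have h1 := abs_mul_exp_le (C := C 3) h3.le (not_lt.1 hx)
    have : 0 ≤ |C 0| * Real.exp (|z 0| * b) + |C 1| * Real.exp (|z 1| * b) := by positivity
    unfold highValue
    linarith

lemma exists_candidateRate_bound {A b d q : ℝ} (hb : 0 < b) {C z : Fin 4 → ℝ}
    (h2 : z 2 < 0) (h3 : z 3 < 0) : ∃ M, ∀ x, |candidateRate A b d q C z x| ≤ M := by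
  obtain ⟨M, hM⟩ := exists_candidate_bound (b := b) (q := q) (C := C) h2 h3
  refine ⟨|A| * M + |d| * (|C 2 * z 2| + |C 3 * z 3|), fun x => ?_⟩
  unfold candidateRate
  refine (abs_add_le _ _).trans (add_le_add ?_ ?_)
  · rw [abs_mul]
    gcongr
    exact hM x
  · split_ifs with hx
    · rw [abs_mul]
      gcongr
      have hx0 : 0 ≤ x := (hb.trans hx).le
      exact (abs_add_le _ _).trans (add_le_add (abs_mul_exp_le h2.le hx0)
        (abs_mul_exp_le h3.le hx0))
    · rw [abs_zero]; positivity

section Candidate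

variable {lam lamb mu mub b d δ q : ℝ} {C z a c : Fin 4 → ℝ}

lemma candidate_of_neg {x : ℝ} (hx : x < 0) : candidate b q C z x = 0 := by
  simp [candidate, hx]

lemma candidate_of_le {x : ℝ} (hx : 0 ≤ x) (hxb : x ≤ b) : candidate b q C z x = lowValue C z x := by
  simp [candidate, hx.not_gt, hxb]

lemma SystemSolution.candidate_of_ge (h : SystemSolution lam lamb mu mub b d δ q C z a c)
    (hb : 0 < b) {x : ℝ} (hx : b ≤ x) : candidate b q C z x = highValue q C z x := by
  rcases hx.eq_or_lt with rfl | hx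
  · rw [candidate_of_le hb.le le_rfl]
    exact h.continuity
  · simp [candidate, (hb.trans hx).not_gt, hx.not_ge]

lemma SystemSolution.claim_coeff (h : SystemSolution lam lamb mu mub b d δ q C z a c)
    (hmu : 0 < mu) (i : Fin 4) : 1 / mu - (-z i) ≠ 0 ∧ 1 / mu / (1 / mu - (-z i)) = a i := by
  have h1 : 1 + mu * z i ≠ 0 := right_ne_zero_of_mul_eq_one (h.claim_inv i)
  have h2 : 1 / mu - (-z i) = (1 + mu * z i) / mu := by field_simp; ring
  refine ⟨h2 ▸ div_ne_zero h1 hmu.ne', ?_⟩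
  have h3 : 1 / mu / ((1 + mu * z i) / mu) = (1 + mu * z i)⁻¹ := by field_simp
  rw [h2, h3]
  exact (eq_inv_of_mul_eq_one_left (h.claim_inv i)).symm

lemma SystemSolution.premium_coeff (h : SystemSolution lam lamb mu mub b d δ q C z a c)
    (hmub : 0 < mub) (i : Fin 4) : z i < 1 / mub ∧ 1 / mub / (1 / mub - z i) = c i := by
  have h1 : 1 - mub * z i ≠ 0 := right_ne_zero_of_mul_eq_one (h.premium_inv i)
  have h2 : 1 / mub - z i = (1 - mub * z i) / mub := by field_simp
  refine ⟨by rw [lt_div_iff₀ hmub, mul_comm]; exact h.premium_lt i, ?_⟩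
  have h3 : 1 / mub / ((1 - mub * z i) / mub) = (1 - mub * z i)⁻¹ := by field_simp
  rw [h2, h3]
  exact (eq_inv_of_mul_eq_one_left (h.premium_inv i)).symm

lemma SystemSolution.integral_claim_low (h : SystemSolution lam lamb mu mub b d δ q C z a c)
    (hmu : 0 < mu) {s t x : ℝ} :
    ∫ y in s..t, 1 / mu * Real.exp (-(1 / mu * y)) * lowValue C z (x - y)
      = C 0 * a 0 * (Real.exp (-(1 / mu * s)) * Real.exp (z 0 * (x - s))
          - Real.exp (-(1 / mu * t)) * Real.exp (z 0 * (x - t)))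
        + C 1 * a 1 * (Real.exp (-(1 / mu * s)) * Real.exp (z 1 * (x - s))
          - Real.exp (-(1 / mu * t)) * Real.exp (z 1 * (x - t))) := by
  have e : ∀ y, 1 / mu * Real.exp (-(1 / mu * y)) * lowValue C z (x - y)
      = C 0 * (1 / mu * Real.exp (-(1 / mu * y)) * Real.exp (-z 0 * (-x + y)))
        + C 1 * (1 / mu * Real.exp (-(1 / mu * y)) * Real.exp (-z 1 * (-x + y))) := by
    intro y
    rw [show -z 0 * (-x + y) = z 0 * (x - y) by ring, show -z 1 * (-x + y) = z 1 * (x - y) by ring,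
      lowValue]
    ring
  simp_rw [e]
  rw [intervalIntegral.integral_add (Continuous.intervalIntegrable (by fun_prop) _ _)
    (Continuous.intervalIntegrable (by fun_prop) _ _), intervalIntegral.integral_const_mul,
    intervalIntegral.integral_const_mul, integral_expDensity_mul_exp (h.claim_coeff hmu 0).1,
    integral_expDensity_mul_exp (h.claim_coeff hmu 1).1, (h.claim_coeff hmu 0).2,
    (h.claim_coeff hmu 1).2]
  ring_nf

lemma SystemSolution.integral_claim_high (h : SystemSolution lam lamb mu mub b d δ q C z a c)
    (hmu : 0 < mu) {s t x : ℝ} :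
    ∫ y in s..t, 1 / mu * Real.exp (-(1 / mu * y)) * highValue q C z (x - y)
      = C 2 * a 2 * (Real.exp (-(1 / mu * s)) * Real.exp (z 2 * (x - s))
          - Real.exp (-(1 / mu * t)) * Real.exp (z 2 * (x - t)))
        + C 3 * a 3 * (Real.exp (-(1 / mu * s)) * Real.exp (z 3 * (x - s))
          - Real.exp (-(1 / mu * t)) * Real.exp (z 3 * (x - t)))
        + q * (Real.exp (-(1 / mu * s)) - Real.exp (-(1 / mu * t))) := by
  -- The constant `q` is treated as an exponential with exponent `0`.
  have e : ∀ y, 1 / mu * Real.exp (-(1 / mu * y)) * highValue q C z (x - y)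
      = C 2 * (1 / mu * Real.exp (-(1 / mu * y)) * Real.exp (-z 2 * (-x + y)))
        + C 3 * (1 / mu * Real.exp (-(1 / mu * y)) * Real.exp (-z 3 * (-x + y)))
        + q * (1 / mu * Real.exp (-(1 / mu * y)) * Real.exp (0 * (0 + y))) := by
    intro y
    rw [show -z 2 * (-x + y) = z 2 * (x - y) by ring, show -z 3 * (-x + y) = z 3 * (x - y) by ring,
      highValue, zero_mul, Real.exp_zero]
    ring
  simp_rw [e]
  have h0 : 1 / mu - 0 ≠ 0 := by rw [sub_zero]; positivity
  rw [intervalIntegral.integral_add (Continuous.intervalIntegrable (by fun_prop) _ _)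
    (Continuous.intervalIntegrable (by fun_prop) _ _),
    intervalIntegral.integral_add (Continuous.intervalIntegrable (by fun_prop) _ _)
    (Continuous.intervalIntegrable (by fun_prop) _ _), intervalIntegral.integral_const_mul,
    intervalIntegral.integral_const_mul, intervalIntegral.integral_const_mul,
    integral_expDensity_mul_exp (h.claim_coeff hmu 2).1,
    integral_expDensity_mul_exp (h.claim_coeff hmu 3).1, integral_expDensity_mul_exp h0,
    (h.claim_coeff hmu 2).2, (h.claim_coeff hmu 3).2, sub_zero, div_self (by positivity)]
  simp only [zero_mul, Real.exp_zero]
  ring_nf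

lemma SystemSolution.integral_premium_low (h : SystemSolution lam lamb mu mub b d δ q C z a c)
    (hmub : 0 < mub) {s t x : ℝ} :
    ∫ y in s..t, 1 / mub * Real.exp (-(1 / mub * y)) * lowValue C z (x + y)
      = C 0 * c 0 * (Real.exp (-(1 / mub * s)) * Real.exp (z 0 * (x + s))
          - Real.exp (-(1 / mub * t)) * Real.exp (z 0 * (x + t)))
        + C 1 * c 1 * (Real.exp (-(1 / mub * s)) * Real.exp (z 1 * (x + s))
          - Real.exp (-(1 / mub * t)) * Real.exp (z 1 * (x + t))) := by
  have e : ∀ y, 1 / mub * Real.exp (-(1 / mub * y)) * lowValue C z (x + y)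
      = C 0 * (1 / mub * Real.exp (-(1 / mub * y)) * Real.exp (z 0 * (x + y)))
        + C 1 * (1 / mub * Real.exp (-(1 / mub * y)) * Real.exp (z 1 * (x + y))) := by
    intro y
    rw [lowValue]
    ring
  simp_rw [e]
  rw [intervalIntegral.integral_add (Continuous.intervalIntegrable (by fun_prop) _ _)
    (Continuous.intervalIntegrable (by fun_prop) _ _), intervalIntegral.integral_const_mul,
    intervalIntegral.integral_const_mul,
    integral_expDensity_mul_exp (sub_pos.2 (h.premium_coeff hmub 0).1).ne',
    integral_expDensity_mul_exp (sub_pos.2 (h.premium_coeff hmub 1).1).ne',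
    (h.premium_coeff hmub 0).2, (h.premium_coeff hmub 1).2]
  ring

lemma SystemSolution.integral_premium_high (h : SystemSolution lam lamb mu mub b d δ q C z a c)
    (hmub : 0 < mub) {s x : ℝ} :
    ∫ y in Ioi s, 1 / mub * Real.exp (-(1 / mub * y)) * highValue q C z (x + y)
      = C 2 * c 2 * (Real.exp (-(1 / mub * s)) * Real.exp (z 2 * (x + s)))
        + C 3 * c 3 * (Real.exp (-(1 / mub * s)) * Real.exp (z 3 * (x + s)))
        + q * Real.exp (-(1 / mub * s)) := by
  have e : ∀ y, 1 / mub * Real.exp (-(1 / mub * y)) * highValue q C z (x + y)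
      = C 2 * (1 / mub * Real.exp (-(1 / mub * y)) * Real.exp (z 2 * (x + y)))
        + C 3 * (1 / mub * Real.exp (-(1 / mub * y)) * Real.exp (z 3 * (x + y)))
        + q * (1 / mub * Real.exp (-(1 / mub * y)) * Real.exp (0 * (0 + y))) := by
    intro y
    rw [highValue, zero_mul, Real.exp_zero]
    ring
  simp_rw [e]
  have h0 : 0 < 1 / mub := by positivity
  have i2 := (integrableOn_expDensity_mul_exp_Ioi (h.premium_coeff hmub 2).1 x s).const_mul (C 2)
  have i3 := (integrableOn_expDensity_mul_exp_Ioi (h.premium_coeff hmub 3).1 x s).const_mul (C 3)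
  have i0 := (integrableOn_expDensity_mul_exp_Ioi h0 0 s).const_mul q
  rw [integral_add (by exact i2.add i3) i0, integral_add i2 i3, integral_const_mul, integral_const_mul,
    integral_const_mul, integral_expDensity_mul_exp_Ioi (h.premium_coeff hmub 2).1,
    integral_expDensity_mul_exp_Ioi (h.premium_coeff hmub 3).1, integral_expDensity_mul_exp_Ioi h0,
    (h.premium_coeff hmub 2).2, (h.premium_coeff hmub 3).2, sub_zero, div_self h0.ne']
  simp only [zero_mul, Real.exp_zero]
  ring

end Candidate

section Candidate

variable {lam lamb mu mub b d δ q : ℝ} {C z a c : Fin 4 → ℝ}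

lemma integrableOn_expDensity_mul {r s M : ℝ} (hr : 0 < r) {f : ℝ → ℝ} (hf : Measurable f)
    (hM : ∀ x, |f x| ≤ M) : IntegrableOn (fun x => r * Real.exp (-(r * x)) * f x) (Ioi s) := by
  have := (integrableOn_exp_mul (s := s) hr hf hM).const_mul r
  simpa only [mul_assoc, IntegrableOn] using this

lemma SystemSolution.integrableOn_claim (h : SystemSolution lam lamb mu mub b d δ q C z a c)
    (hmu : 0 < mu) (x s : ℝ) :
    IntegrableOn (fun y => 1 / mu * Real.exp (-(1 / mu * y)) * candidate b q C z (x - y))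
      (Ioi s) := by
  obtain ⟨M, hM⟩ := exists_candidate_bound (b := b) (q := q) (C := C) h.neg_two h.neg_three
  exact integrableOn_expDensity_mul (by positivity)
    ((measurable_candidate b q C z).comp (measurable_const.sub measurable_id)) fun y => hM _

lemma SystemSolution.integrableOn_premium (h : SystemSolution lam lamb mu mub b d δ q C z a c)
    (hmub : 0 < mub) (x s : ℝ) :
    IntegrableOn (fun y => 1 / mub * Real.exp (-(1 / mub * y)) * candidate b q C z (x + y))
      (Ioi s) := by
  obtain ⟨M, hM⟩ := exists_candidate_bound (b := b) (q := q) (C := C) h.neg_two h.neg_three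
  exact integrableOn_expDensity_mul (by positivity)
    ((measurable_candidate b q C z).comp (measurable_const.add measurable_id)) fun y => hM _

lemma SystemSolution.integral_claim_Ioi (h : SystemSolution lam lamb mu mub b d δ q C z a c)
    (hmu : 0 < mu) (x : ℝ) :
    ∫ y, candidate b q C z (x - y) ∂expMeasure (1 / mu)
      = ∫ y in (0 : ℝ)..x, 1 / mu * Real.exp (-(1 / mu * y)) * candidate b q C z (x - y) := by
  rw [integral_expMeasure (by positivity), ← intervalIntegral.integral_interval_add_Ioi
    (h.integrableOn_claim hmu x 0) (h.integrableOn_claim hmu x x), add_eq_left]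
  refine setIntegral_eq_zero_of_forall_eq_zero fun y hy => ?_
  rw [candidate_of_neg (sub_neg.2 hy), mul_zero]

/-- The terms in exp (z i * x) agree by the characteristic equation. What is left is a multiple of
exp (-x / mu), from the cut-off at ruin, which `claims_zero` removes, and a multiple of exp (-(b -
x) / mub), from premiums that cross the threshold, which `premiums` removes. -/
lemma SystemSolution.integral_eq_candidateRate_of_le
    (h : SystemSolution lam lamb mu mub b d δ q C z a c) (hmu : 0 < mu) (hmub : 0 < mub)
    (hb : 0 < b) {x : ℝ} (hx : 0 ≤ x) (hxb : x ≤ b) :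
    lam * ∫ y, candidate b q C z (x - y) ∂expMeasure (1 / mu)
      + lamb * ∫ y, candidate b q C z (x + y) ∂expMeasure (1 / mub)
      = candidateRate (lam + lamb + δ) b d q C z x := by
  have h1 : ∫ y in (0 : ℝ)..x, 1 / mu * Real.exp (-(1 / mu * y)) * candidate b q C z (x - y)
      = ∫ y in (0 : ℝ)..x, 1 / mu * Real.exp (-(1 / mu * y)) * lowValue C z (x - y) := by
    refine intervalIntegral.integral_congr fun y hy => ?_
    rw [uIcc_of_le hx] at hy
    rw [candidate_of_le (by linarith [hy.2]) (by linarith [hy.1])]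
  have h2 : ∫ y in (0 : ℝ)..(b - x),
      1 / mub * Real.exp (-(1 / mub * y)) * candidate b q C z (x + y)
      = ∫ y in (0 : ℝ)..(b - x), 1 / mub * Real.exp (-(1 / mub * y)) * lowValue C z (x + y) := by
    refine intervalIntegral.integral_congr fun y hy => ?_
    rw [uIcc_of_le (by linarith)] at hy
    rw [candidate_of_le (by linarith [hy.1]) (by linarith [hy.2])]
  have h3 : ∫ y in Ioi (b - x), 1 / mub * Real.exp (-(1 / mub * y)) * candidate b q C z (x + y)
      = ∫ y in Ioi (b - x), 1 / mub * Real.exp (-(1 / mub * y)) * highValue q C z (x + y) := by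
    refine setIntegral_congr_fun measurableSet_Ioi fun y hy => ?_
    have hy' : b - x < y := hy
    rw [h.candidate_of_ge hb (by linarith)]
  rw [h.integral_claim_Ioi hmu, h1, h.integral_claim_low hmu,
    integral_expMeasure (by positivity), ← intervalIntegral.integral_interval_add_Ioi
    (h.integrableOn_premium hmub x 0) (h.integrableOn_premium hmub x (b - x)), h2, h3,
    h.integral_premium_low hmub, h.integral_premium_high hmub, candidateRate,
    candidate_of_le hx hxb, if_neg hxb.not_gt, lowValue]
  simp only [mul_zero, neg_zero, Real.exp_zero, sub_zero, sub_self, one_mul, mul_one,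
    add_sub_cancel, add_zero]
  linear_combination C 0 * Real.exp (z 0 * x) * h.char_zero
    + C 1 * Real.exp (z 1 * x) * h.char_one - lam * Real.exp (-(1 / mu * x)) * h.claims_zero
    - lamb * Real.exp (-(1 / mub * (b - x))) * h.premiums

/-- Here claims reach both branches: the boundary terms at `0` and at `b` vanish by `claims_zero`
and `claims`. The constant `q` returns only `(lam + lamb) * q` from the jumps, which is why the
source `δ * q` appears. -/
lemma SystemSolution.integral_eq_candidateRate_of_gt
    (h : SystemSolution lam lamb mu mub b d δ q C z a c) (hmu : 0 < mu) (hmub : 0 < mub)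
    (hb : 0 < b) {x : ℝ} (hx : b < x) :
    lam * ∫ y, candidate b q C z (x - y) ∂expMeasure (1 / mu)
      + lamb * ∫ y, candidate b q C z (x + y) ∂expMeasure (1 / mub) + δ * q
      = candidateRate (lam + lamb + δ) b d q C z x := by
  have h0 : ∀ s, 0 ≤ s → ∀ t, 0 ≤ t → IntervalIntegrable
      (fun y => 1 / mu * Real.exp (-(1 / mu * y)) * candidate b q C z (x - y)) volume s t := by
    intro s hs t ht
    -- Starting at `-1` makes the open half-line contain the closed interval, including a possible
    -- endpoint `0`.
    refine ((h.integrableOn_claim hmu x (-1)).mono_set fun u hu => ?_).intervalIntegrable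
    have h1 := (Set.uIcc_subset_Icc (a₂ := 0) (b₂ := max s t) ⟨hs, le_max_left _ _⟩
      ⟨ht, le_max_right _ _⟩ hu).1
    exact lt_of_lt_of_le (by norm_num) h1
  have h1 : ∫ y in (0 : ℝ)..(x - b),
      1 / mu * Real.exp (-(1 / mu * y)) * candidate b q C z (x - y)
      = ∫ y in (0 : ℝ)..(x - b), 1 / mu * Real.exp (-(1 / mu * y)) * highValue q C z (x - y) := by
    refine intervalIntegral.integral_congr fun y hy => ?_
    rw [uIcc_of_le (by linarith)] at hy
    rw [h.candidate_of_ge hb (by linarith [hy.2])]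
  have h2 : ∫ y in (x - b)..x, 1 / mu * Real.exp (-(1 / mu * y)) * candidate b q C z (x - y)
      = ∫ y in (x - b)..x, 1 / mu * Real.exp (-(1 / mu * y)) * lowValue C z (x - y) := by
    refine intervalIntegral.integral_congr fun y hy => ?_
    rw [uIcc_of_le (by linarith)] at hy
    rw [candidate_of_le (by linarith [hy.2]) (by linarith [hy.1])]
  have h3 : ∫ y in Ioi 0, 1 / mub * Real.exp (-(1 / mub * y)) * candidate b q C z (x + y)
      = ∫ y in Ioi 0, 1 / mub * Real.exp (-(1 / mub * y)) * highValue q C z (x + y) := by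
    refine setIntegral_congr_fun measurableSet_Ioi fun y hy => ?_
    have hy' : 0 < y := hy
    rw [h.candidate_of_ge hb (by linarith)]
  rw [h.integral_claim_Ioi hmu, ← intervalIntegral.integral_add_adjacent_intervals
    (h0 0 le_rfl (x - b) (by linarith)) (h0 (x - b) (by linarith) x (by linarith)), h1, h2,
    h.integral_claim_low hmu, h.integral_claim_high hmu,
    integral_expMeasure (by positivity), h3, h.integral_premium_high hmub, candidateRate,
    h.candidate_of_ge hb hx.le, if_pos hx, highValue]
  simp only [mul_zero, neg_zero, Real.exp_zero, sub_zero, sub_self, one_mul, mul_one,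
    sub_sub_cancel, add_zero]
  linear_combination C 2 * Real.exp (z 2 * x) * h.char_two
    + C 3 * Real.exp (z 3 * x) * h.char_three - lam * Real.exp (-(1 / mu * x)) * h.claims_zero
    + lam * Real.exp (-(1 / mu * (x - b))) * h.claims

lemma SystemSolution.integrableOn_candidateRate
    (h : SystemSolution lam lamb mu mub b d δ q C z a c) (hb : 0 < b) {A A' : ℝ} (hA : 0 < A)
    (x s : ℝ) :
    IntegrableOn (fun t => Real.exp (-(A * t)) * candidateRate A' b d q C z (flow d b x t))
      (Ioi s) := by
  obtain ⟨M, hM⟩ := exists_candidateRate_bound (A := A') (d := d) (q := q) (C := C) hb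
    h.neg_two h.neg_three
  exact integrableOn_exp_mul hA ((measurable_candidateRate A' b d q C z).comp (by fun_prop))
    fun t => hM _

/-- The candidate is recovered from its rate along the flow. -/
lemma SystemSolution.candidate_eq_integral
    (h : SystemSolution lam lamb mu mub b d δ q C z a c) (hb : 0 < b) (hd : 0 < d) {A : ℝ}
    (hA : 0 < A) (x : ℝ) :
    candidate b q C z x
      = ∫ t in Ioi 0, Real.exp (-(A * t)) * candidateRate A b d q C z (flow d b x t) := by
  rcases le_or_gt x b with hxb | hxb
  · have h1 : ∫ t in Ioi 0, Real.exp (-(A * t)) * candidateRate A b d q C z (flow d b x t)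
        = ∫ t in Ioi 0, Real.exp (-(A * t)) * (A * candidate b q C z x) := by
      refine setIntegral_congr_fun measurableSet_Ioi fun t ht => ?_
      rw [flow_of_le hd.le (le_of_lt ht) hxb, candidateRate, if_neg hxb.not_gt, add_zero]
    rw [h1, integral_mul_const, integral_exp_neg_mul_Ioi hA]
    simp only [mul_zero, neg_zero, Real.exp_zero]
    field_simp
  -- The flow reaches `b` at time `s` and rests there.
  · set s := (x - b) / d with hs
    have hds : d * s = x - b := mul_div_cancel₀ _ hd.ne'
    have hs0 : 0 ≤ s := div_nonneg (by linarith) hd.le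
    rw [← intervalIntegral.integral_interval_add_Ioi (h.integrableOn_candidateRate hb hA x 0)
      (h.integrableOn_candidateRate hb hA x s)]
    have h1 : ∫ t in Ioi s, Real.exp (-(A * t)) * candidateRate A b d q C z (flow d b x t)
        = ∫ t in Ioi s, Real.exp (-(A * t)) * (A * highValue q C z b) := by
      refine setIntegral_congr_fun measurableSet_Ioi fun t ht => ?_
      have ht' := mul_lt_mul_of_pos_left (show s < t from ht) hd
      rw [flow_of_gt hxb.le, max_eq_left (by linarith), candidateRate, if_neg (lt_irrefl b),
        add_zero, h.candidate_of_ge hb le_rfl]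
    have h2 : ∫ t in (0 : ℝ)..s, Real.exp (-(A * t)) * candidateRate A b d q C z (flow d b x t)
        = ∫ t in (0 : ℝ)..s, Real.exp (-(A * t)) * (A * highValue q C z (x - d * t) +
          d * (C 2 * z 2 * Real.exp (z 2 * (x - d * t))
            + C 3 * z 3 * Real.exp (z 3 * (x - d * t)))) := by
      refine intervalIntegral.integral_congr_ae ?_
      have : ∀ᵐ r : ℝ, r ≠ s := by simp [ae_iff]
      filter_upwards [this] with t hts ht
      rw [uIoc_of_le hs0] at ht
      have ht' := mul_lt_mul_of_pos_left (lt_of_le_of_ne ht.2 hts) hd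
      rw [flow_of_gt hxb.le, max_eq_right (by linarith), candidateRate, if_pos (by linarith),
        h.candidate_of_ge hb (by linarith)]
    -- Along the flow the integrand is the derivative of -exp (-A t) w (x - d t). Its boundary value
    -- at `s` cancels the contribution of the rest at `b`.
    have hderiv : ∀ t ∈ uIcc 0 s, HasDerivAt
        (fun t => -(Real.exp (-(A * t)) * highValue q C z (x - d * t)))
        (Real.exp (-(A * t)) * (A * highValue q C z (x - d * t) +
          d * (C 2 * z 2 * Real.exp (z 2 * (x - d * t))
            + C 3 * z 3 * Real.exp (z 3 * (x - d * t))))) t := by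
      intro t _
      have e1 : HasDerivAt (fun y => Real.exp (-(A * y))) (Real.exp (-(A * t)) * (-(A * 1))) t :=
        (((hasDerivAt_id t).const_mul A).neg).exp
      have e2 : ∀ k, HasDerivAt (fun y => Real.exp (k * (x - d * y)))
          (Real.exp (k * (x - d * t)) * (k * -(d * 1))) t := fun k =>
        ((((hasDerivAt_id t).const_mul d).const_sub x).const_mul k).exp
      have e3 : HasDerivAt (fun y => highValue q C z (x - d * y))
          (C 2 * (Real.exp (z 2 * (x - d * t)) * (z 2 * -(d * 1)))
            + C 3 * (Real.exp (z 3 * (x - d * t)) * (z 3 * -(d * 1)))) t :=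
        (((e2 (z 2)).const_mul (C 2)).add ((e2 (z 3)).const_mul (C 3))).add_const q
      refine (e1.mul e3).neg.congr_deriv ?_
      ring
    rw [h1, h2, intervalIntegral.integral_eq_sub_of_hasDerivAt hderiv
      (Continuous.intervalIntegrable (by unfold highValue; fun_prop) _ _), integral_mul_const,
      integral_exp_neg_mul_Ioi hA, h.candidate_of_ge hb hxb.le, hds]
    simp only [mul_zero, neg_zero, Real.exp_zero, sub_zero, one_mul, sub_sub_cancel]
    field_simp
    ring

/-- The source term of the equation of the candidate. -/
lemma SystemSolution.candidateRate_eq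
    (h : SystemSolution lam lamb mu mub b d δ q C z a c) (hmu : 0 < mu) (hmub : 0 < mub)
    (hb : 0 < b) {x : ℝ} (hx : 0 ≤ x) :
    candidateRate (lam + lamb + δ) b d q C z x
      = dividendRate (δ * q) b x + (lam * ∫ y, candidate b q C z (x - y) ∂expMeasure (1 / mu)
      + lamb * ∫ y, candidate b q C z (x + y) ∂expMeasure (1 / mub)) := by
  rcases le_or_gt x b with hxb | hxb
  · rw [dividendRate, if_neg hxb.not_gt, zero_add,
      h.integral_eq_candidateRate_of_le hmu hmub hb hx hxb]
  · rw [dividendRate, if_pos hxb, add_comm (δ * q), h.integral_eq_candidateRate_of_gt hmu hmub hb hxb]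

/-- A lower bound `-m` improves by the contraction factor: the dividend source is nonnegative, the
jump terms are at least `-(lam + lamb) * m`, and integration against exp (-(lam + lamb + δ) t)
divides by `lam + lamb + δ`. -/
lemma SystemSolution.neg_mul_le_candidate
    (h : SystemSolution lam lamb mu mub b d δ q C z a c) (hlam : 0 < lam) (hlamb : 0 < lamb)
    (hmu : 0 < mu) (hmub : 0 < mub) (hb : 0 < b) (hd : 0 < d) (hδ : 0 < δ) (hq : 0 ≤ q)
    {m : ℝ} (hm0 : 0 ≤ m) (hm : ∀ x, -m ≤ candidate b q C z x) (x : ℝ) :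
    -((lam + lamb) / (lam + lamb + δ) * m) ≤ candidate b q C z x := by
  have hA : 0 < lam + lamb + δ := by positivity
  rcases lt_or_ge x 0 with hx | hx
  · rw [candidate_of_neg hx, neg_nonpos]
    positivity
  obtain ⟨M, hM⟩ := exists_candidate_bound (b := b) (q := q) (C := C) h.neg_two h.neg_three
  have hint : ∀ r, 0 < r → ∀ f : ℝ → ℝ, Measurable f →
      -m ≤ ∫ y, candidate b q C z (f y) ∂expMeasure r := by
    intro r hr f hf
    have := isProbabilityMeasure_expMeasure hr
    have h1 : ∫ _, -m ∂expMeasure r ≤ ∫ y, candidate b q C z (f y) ∂expMeasure r := by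
      refine integral_mono (integrable_const _) ?_ fun y => hm _
      exact Integrable.of_bound ((measurable_candidate b q C z).comp hf).aestronglyMeasurable M
        (Eventually.of_forall fun y => hM _)
    simpa using h1
  have hrate : ∀ u, 0 ≤ u →
      -((lam + lamb) * m) ≤ candidateRate (lam + lamb + δ) b d q C z u := by
    intro u hu
    rw [h.candidateRate_eq hmu hmub hb hu]
    have h1 := mul_le_mul_of_nonneg_left (hint (1 / mu) (by positivity) (fun y => u - y)
      (by fun_prop)) hlam.le
    have h2 := mul_le_mul_of_nonneg_left (hint (1 / mub) (by positivity) (fun y => u + y)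
      (by fun_prop)) hlamb.le
    have h3 := dividendRate_nonneg (mul_nonneg hδ.le hq) b u
    linarith
  rw [h.candidate_eq_integral hb hd hA x]
  have h4 : ∫ t in Ioi 0, Real.exp (-((lam + lamb + δ) * t)) * -((lam + lamb) * m)
      ≤ ∫ t in Ioi 0, Real.exp (-((lam + lamb + δ) * t)) *
        candidateRate (lam + lamb + δ) b d q C z (flow d b x t) := by
    refine setIntegral_mono_on ?_ (h.integrableOn_candidateRate hb hA x 0) measurableSet_Ioi
      fun t _ => mul_le_mul_of_nonneg_left (hrate _ (flow_nonneg hb.le hx t)) (Real.exp_pos _).le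
    exact integrableOn_exp_mul hA measurable_const (M := |-((lam + lamb) * m)|) fun _ => le_rfl
  refine le_trans (le_of_eq ?_) h4
  rw [integral_mul_const, integral_exp_neg_mul_Ioi hA]
  simp only [mul_zero, neg_zero, Real.exp_zero]
  ring

/-- The bound `-M` of the bounded candidate improves to `-(ρ ^ n * M)` for every `n`. The argument
is purely analytic, so it also covers `q = 0`, where no dividends are paid. -/
lemma SystemSolution.candidate_nonneg
    (h : SystemSolution lam lamb mu mub b d δ q C z a c) (hlam : 0 < lam) (hlamb : 0 < lamb)
    (hmu : 0 < mu) (hmub : 0 < mub) (hb : 0 < b) (hd : 0 < d) (hδ : 0 < δ) (hq : 0 ≤ q) (x : ℝ) :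
    0 ≤ candidate b q C z x := by
  obtain ⟨M, hM⟩ := exists_candidate_bound (b := b) (q := q) (C := C) h.neg_two h.neg_three
  have hM0 : 0 ≤ M := (abs_nonneg _).trans (hM 0)
  set ρ := (lam + lamb) / (lam + lamb + δ) with hρ
  have hρ0 : 0 ≤ ρ := by positivity
  have hρ1 : ρ < 1 := by rw [hρ, div_lt_one (by positivity)]; linarith
  have hn : ∀ n : ℕ, ∀ x, -(ρ ^ n * M) ≤ candidate b q C z x := by
    intro n
    induction n with
    | zero => intro x; simpa using (abs_le.1 (hM x)).1
    | succ n ih =>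
      intro x
      have := h.neg_mul_le_candidate hlam hlamb hmu hmub hb hd hδ hq (by positivity) ih x
      rwa [← mul_assoc, ← pow_succ'] at this
  have hlim : Tendsto (fun n : ℕ => -(ρ ^ n * M)) atTop (𝓝 0) := by
    simpa using ((tendsto_pow_atTop_nhds_zero_of_lt_one hρ0 hρ1).mul_const M).neg
  exact le_of_tendsto' hlim fun n => hn n x

end Candidate

/-! ### Uniqueness of the constants, the fixed point, and the contraction -/

section Operator

variable {lam lamb mu mub b d δ q : ℝ} {C z a c : Fin 4 → ℝ}

lemma SystemSolution.neg (h : SystemSolution lam lamb mu mub b d δ 0 C z a c) :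
    SystemSolution lam lamb mu mub b d δ 0 (-C) z a c where
  claim_inv := h.claim_inv
  premium_inv := h.premium_inv
  premium_lt := h.premium_lt
  neg_two := h.neg_two
  neg_three := h.neg_three
  char_zero := h.char_zero
  char_one := h.char_one
  char_two := h.char_two
  char_three := h.char_three
  claims_zero := by simp only [Pi.neg_apply]; linear_combination -h.claims_zero
  premiums := by simp only [Pi.neg_apply]; linear_combination -h.premiums
  continuity := by simp only [Pi.neg_apply]; linear_combination -h.continuity
  claims := by simp only [Pi.neg_apply]; linear_combination -h.claims

/-- The two equations have determinant exp (z₁ x + z₂ y) - exp (z₁ y + z₂ x), which vanishes only if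
(z₁ - z₂) (x - y) = 0. -/
lemma eq_zero_of_exp_combination {C₁ C₂ z₁ z₂ x y : ℝ} (hz : z₁ ≠ z₂) (hxy : x ≠ y)
    (hx : C₁ * Real.exp (z₁ * x) + C₂ * Real.exp (z₂ * x) = 0)
    (hy : C₁ * Real.exp (z₁ * y) + C₂ * Real.exp (z₂ * y) = 0) : C₁ = 0 ∧ C₂ = 0 := by
  have hne : Real.exp (z₁ * x) * Real.exp (z₂ * y) - Real.exp (z₁ * y) * Real.exp (z₂ * x) ≠ 0 := by
    rw [← Real.exp_add, ← Real.exp_add, sub_ne_zero]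
    intro h
    have h1 := Real.exp_injective h
    have h2 : (z₁ - z₂) * (x - y) = 0 := by linear_combination h1
    rcases mul_eq_zero.1 h2 with h3 | h3
    · exact hz (sub_eq_zero.1 h3)
    · exact hxy (sub_eq_zero.1 h3)
  constructor
  · refine (mul_eq_zero.1 ?_).resolve_right hne
    linear_combination Real.exp (z₂ * y) * hx - Real.exp (z₂ * x) * hy
  · refine (mul_eq_zero.1 ?_).resolve_right hne
    linear_combination Real.exp (z₁ * x) * hy - Real.exp (z₁ * y) * hx

/-- The homogeneous linear system has the trivial solution only. -/
lemma SystemSolution.eq_zero (h : SystemSolution lam lamb mu mub b d δ 0 C z a c)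
    (hlam : 0 < lam) (hlamb : 0 < lamb) (hmu : 0 < mu) (hmub : 0 < mub) (hb : 0 < b) (hd : 0 < d)
    (hδ : 0 < δ) (h01 : z 0 ≠ z 1) (h23 : z 2 ≠ z 3) : C = 0 := by
  -- Both `C` and `-C` solve the homogeneous system, so the candidate is nonnegative and
  -- nonpositive, hence zero.
  have h1 := h.candidate_nonneg hlam hlamb hmu hmub hb hd hδ le_rfl
  have h2 := h.neg.candidate_nonneg hlam hlamb hmu hmub hb hd hδ le_rfl
  have hlow : ∀ x, 0 ≤ x → x ≤ b →
      C 0 * Real.exp (z 0 * x) + C 1 * Real.exp (z 1 * x) = 0 := by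
    intro x hx hxb
    have e1 := h1 x
    have e2 := h2 x
    rw [candidate_of_le hx hxb, lowValue] at e1 e2
    simp only [Pi.neg_apply] at e2
    linarith
  have hhigh : ∀ x, b ≤ x → C 2 * Real.exp (z 2 * x) + C 3 * Real.exp (z 3 * x) = 0 := by
    intro x hx
    have e1 := h1 x
    have e2 := h2 x
    rw [h.candidate_of_ge hb hx, highValue] at e1
    rw [h.neg.candidate_of_ge hb hx, highValue] at e2
    simp only [Pi.neg_apply] at e2
    linarith
  have hC01 := eq_zero_of_exp_combination h01 hb.ne (hlow 0 le_rfl hb.le) (hlow b hb.le le_rfl)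
  have hC23 := eq_zero_of_exp_combination h23 (show b ≠ b + 1 by simp) (hhigh b le_rfl)
    (hhigh (b + 1) (by simp))
  funext i
  fin_cases i
  exacts [hC01.1, hC01.2, hC23.1, hC23.2]

lemma SystemSolution.ofReal_integral (h : SystemSolution lam lamb mu mub b d δ q C z a c)
    (hnn : ∀ x, 0 ≤ candidate b q C z x) {r : ℝ} (hr : 0 < r) {f : ℝ → ℝ} (hf : Measurable f) :
    ENNReal.ofReal (∫ y, candidate b q C z (f y) ∂expMeasure r)
      = ∫⁻ y, ENNReal.ofReal (candidate b q C z (f y)) ∂expMeasure r := by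
  have := isProbabilityMeasure_expMeasure hr
  obtain ⟨M, hM⟩ := exists_candidate_bound (b := b) (q := q) (C := C) h.neg_two h.neg_three
  refine ofReal_integral_eq_lintegral_ofReal ?_ (Eventually.of_forall fun y => hnn _)
  exact Integrable.of_bound ((measurable_candidate b q C z).comp hf).aestronglyMeasurable M
    (Eventually.of_forall fun y => hM _)

/-- With `q = d / δ` the source `δ * q` is the true dividend rate `d`. The equation for the rate and
its integration along the flow combine to the fixed point equation, and nonnegativity of the
candidate lets it pass to `ℝ≥0∞`. -/
lemma SystemSolution.renewalOp_candidate
    (h : SystemSolution lam lamb mu mub b d δ (d / δ) C z a c) (hlam : 0 < lam) (hlamb : 0 < lamb)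
    (hmu : 0 < mu) (hmub : 0 < mub) (hb : 0 < b) (hd : 0 < d) (hδ : 0 < δ) :
    renewalOp δ d b lam lamb (expMeasure (1 / mu)) (expMeasure (1 / mub))
      (fun x => ENNReal.ofReal (candidate b (d / δ) C z x))
      = fun x => ENNReal.ofReal (candidate b (d / δ) C z x) := by
  have hA : 0 < lam + lamb + δ := by positivity
  have hnn := h.candidate_nonneg hlam hlamb hmu hmub hb hd hδ (by positivity)
  have hint : ∀ r (f : ℝ → ℝ), 0 ≤ ∫ y, candidate b (d / δ) C z (f y) ∂expMeasure r :=
    fun r f => integral_nonneg fun y => hnn _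
  funext x
  unfold renewalOp
  split_ifs with hx
  · rw [candidate_of_neg hx, ENNReal.ofReal_zero]
  have hrate : ∀ u, 0 ≤ u → ENNReal.ofReal (candidateRate (lam + lamb + δ) b d (d / δ) C z u)
      = ENNReal.ofReal (dividendRate d b u) + (ENNReal.ofReal lam *
          ∫⁻ y, ENNReal.ofReal (candidate b (d / δ) C z (u - y)) ∂expMeasure (1 / mu)
        + ENNReal.ofReal lamb *
          ∫⁻ y, ENNReal.ofReal (candidate b (d / δ) C z (u + y)) ∂expMeasure (1 / mub)) := by
    intro u hu
    rw [h.candidateRate_eq hmu hmub hb hu, mul_div_cancel₀ d hδ.ne',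
      ENNReal.ofReal_add (dividendRate_nonneg hd.le b u)
        (add_nonneg (mul_nonneg hlam.le (hint _ _)) (mul_nonneg hlamb.le (hint _ _))),
      ENNReal.ofReal_add (mul_nonneg hlam.le (hint _ _)) (mul_nonneg hlamb.le (hint _ _)),
      ENNReal.ofReal_mul hlam.le, ENNReal.ofReal_mul hlamb.le,
      h.ofReal_integral hnn (by positivity) (by fun_prop),
      h.ofReal_integral hnn (by positivity) (by fun_prop)]
  have hrate0 : ∀ u, 0 ≤ u → 0 ≤ candidateRate (lam + lamb + δ) b d (d / δ) C z u := by
    intro u hu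
    rw [h.candidateRate_eq hmu hmub hb hu, mul_div_cancel₀ d hδ.ne']
    exact add_nonneg (dividendRate_nonneg hd.le b u)
      (add_nonneg (mul_nonneg hlam.le (hint _ _)) (mul_nonneg hlamb.le (hint _ _)))
  rw [h.candidate_eq_integral hb hd hA x, ofReal_integral_eq_lintegral_ofReal
    (h.integrableOn_candidateRate hb hA x 0) (Eventually.of_forall fun t =>
      mul_nonneg (Real.exp_pos _).le (hrate0 _ (flow_nonneg hb.le (not_lt.1 hx) t)))]
  refine lintegral_congr fun t => ?_
  rw [ENNReal.ofReal_mul (Real.exp_pos _).le, hrate _ (flow_nonneg hb.le (not_lt.1 hx) t)]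

/-- The discounted mass of the first arrival is (λ + λ̄) ∫ exp (-A t) dt = (λ + λ̄) / A. An additive
error expresses the contraction without subtraction in `ℝ≥0∞`, and `u` and `v` need not be
measurable. -/
lemma renewalOp_le_add {ν ν' : Measure ℝ} [IsProbabilityMeasure ν] [IsProbabilityMeasure ν']
    (hlam : 0 < lam) (hlamb : 0 < lamb) (hδ : 0 < δ) {u v : ℝ → ℝ≥0∞} {ε : ℝ≥0∞}
    (huv : ∀ x, u x ≤ v x + ε) (x : ℝ) :
    renewalOp δ d b lam lamb ν ν' u x ≤ renewalOp δ d b lam lamb ν ν' v x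
      + ENNReal.ofReal ((lam + lamb) / (lam + lamb + δ)) * ε := by
  unfold renewalOp
  split_ifs with hx
  · exact zero_le
  have hA : 0 < lam + lamb + δ := by positivity
  have hε : ENNReal.ofReal ((lam + lamb) / (lam + lamb + δ)) * ε
      = ∫⁻ t in Ioi 0, ENNReal.ofReal (Real.exp (-((lam + lamb + δ) * t))) *
        (ENNReal.ofReal lam * ε + ENNReal.ofReal lamb * ε) := by
    rw [lintegral_mul_const _ (by fun_prop), lintegral_exp_neg hA, ← add_mul,
      ← ENNReal.ofReal_add hlam.le hlamb.le, ← mul_assoc, ← ENNReal.ofReal_mul (by positivity)]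
    congr 2; ring
  rw [hε, ← lintegral_add_right _ (by fun_prop)]
  refine lintegral_mono fun t => ?_
  rw [← mul_add]
  refine mul_le_mul' le_rfl ?_
  have h1 : ∫⁻ y, u (flow d b x t - y) ∂ν ≤ ∫⁻ y, v (flow d b x t - y) ∂ν + ε := by
    refine (lintegral_mono fun y => huv (flow d b x t - y)).trans (le_of_eq ?_)
    rw [lintegral_add_right _ measurable_const]
    simp
  have h2 : ∫⁻ y, u (flow d b x t + y) ∂ν' ≤ ∫⁻ y, v (flow d b x t + y) ∂ν' + ε := by
    refine (lintegral_mono fun y => huv (flow d b x t + y)).trans (le_of_eq ?_)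
    rw [lintegral_add_right _ measurable_const]
    simp
  calc _ ≤ ENNReal.ofReal (dividendRate d b (flow d b x t)) +
        (ENNReal.ofReal lam * (∫⁻ y, v (flow d b x t - y) ∂ν + ε)
          + ENNReal.ofReal lamb * (∫⁻ y, v (flow d b x t + y) ∂ν' + ε)) := by gcongr
    _ = _ := by ring

lemma iterate_renewalOp_le_add {ν ν' : Measure ℝ} [IsProbabilityMeasure ν]
    [IsProbabilityMeasure ν'] (hlam : 0 < lam) (hlamb : 0 < lamb) (hδ : 0 < δ) {u v : ℝ → ℝ≥0∞}
    {ε : ℝ≥0∞} (huv : ∀ x, u x ≤ v x + ε) (n : ℕ) (x : ℝ) :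
    (renewalOp δ d b lam lamb ν ν')^[n] u x ≤ (renewalOp δ d b lam lamb ν ν')^[n] v x
      + ENNReal.ofReal ((lam + lamb) / (lam + lamb + δ)) ^ n * ε := by
  induction n generalizing x with
  | zero => simpa using huv x
  | succ n ih =>
    rw [Function.iterate_succ_apply', Function.iterate_succ_apply', pow_succ', mul_assoc]
    exact renewalOp_le_add hlam hlamb hδ ih x

lemma measurable_iterate_renewalStep (a : ℝ≥0∞) (n : ℕ) :
    Measurable ((renewalStep δ d b)^[n] fun _ => a) := by
  induction n with
  | zero => exact measurable_const
  | succ n ih =>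
    rw [Function.iterate_succ_apply']
    exact measurable_renewalStep ih

lemma meanValue_iterate {ν ν' : Measure ℝ} [IsProbabilityMeasure ν] [IsProbabilityMeasure ν']
    [IsProbabilityMeasure (expMeasure lam)] [IsProbabilityMeasure (expMeasure lamb)]
    (hlam : 0 < lam) (hlamb : 0 < lamb) (a : ℝ≥0∞) (n : ℕ) :
    meanValue (arrivalsLaw (expMeasure lam) ν) (arrivalsLaw (expMeasure lamb) ν')
        ((renewalStep δ d b)^[n] fun _ => a)
      = (renewalOp δ d b lam lamb ν ν')^[n] fun _ => a := by
  induction n with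
  | zero => funext x; simp [meanValue]
  | succ n ih =>
    rw [Function.iterate_succ_apply', Function.iterate_succ_apply', ← ih]
    funext x
    exact meanValue_renewalStep hlam hlamb (measurable_iterate_renewalStep a n) x

lemma tendsto_ofReal_pow_mul {ρ : ℝ} (hρ : ρ < 1) {ε : ℝ≥0∞} (hε : ε ≠ ∞) :
    Tendsto (fun n : ℕ => ENNReal.ofReal ρ ^ n * ε) atTop (𝓝 0) := by
  have h := ENNReal.Tendsto.mul_const (b := ε)
    (ENNReal.tendsto_pow_atTop_nhds_zero_of_lt_one (r := ENNReal.ofReal ρ) (by simpa using hρ))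
    (Or.inr hε)
  simpa using h

/-- A random variable squeezed between the iterates of the renewal recursion. -/
lemma lintegral_eq_of_sandwich {Ω : Type*} [MeasurableSpace Ω] {P : Measure Ω}
    {V : Ω → ℝ≥0∞} {L U : ℕ → Ω → ℝ≥0∞} (hL : ∀ n, AEMeasurable (L n) P)
    (hU : ∀ n, AEMeasurable (U n) P) (hLV : ∀ᵐ ω ∂P, ∀ n, L n ω ≤ V ω)
    (hVU : ∀ᵐ ω ∂P, ∀ n, V ω ≤ U n ω) {w : ℝ≥0∞} (hw : w ≠ ∞) {e₁ e₂ : ℕ → ℝ≥0∞}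
    (h₁ : ∀ n, w ≤ ∫⁻ ω, L n ω ∂P + e₁ n) (h₂ : ∀ n, ∫⁻ ω, U n ω ∂P ≤ w + e₂ n)
    (he₁ : Tendsto e₁ atTop (𝓝 0)) (he₂ : Tendsto e₂ atTop (𝓝 0)) :
    AEMeasurable V P ∧ ∫⁻ ω, V ω ∂P = w := by
  set L' : Ω → ℝ≥0∞ := fun ω => ⨆ n, L n ω
  set U' : Ω → ℝ≥0∞ := fun ω => ⨅ n, U n ω
  have hL' : AEMeasurable L' P := AEMeasurable.iSup hL
  have hU' : AEMeasurable U' P := AEMeasurable.iInf hU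
  have hLV' : L' ≤ᵐ[P] V := by
    filter_upwards [hLV] with ω h using iSup_le h
  have hVU' : V ≤ᵐ[P] U' := by
    filter_upwards [hVU] with ω h using le_iInf h
  have hwL : w ≤ ∫⁻ ω, L' ω ∂P := by
    have hlim : Tendsto (fun n => ∫⁻ ω, L' ω ∂P + e₁ n) atTop (𝓝 (∫⁻ ω, L' ω ∂P)) := by
      simpa using he₁.const_add (∫⁻ ω, L' ω ∂P)
    refine ge_of_tendsto' hlim fun n => (h₁ n).trans ?_
    gcongr with ω
    exact le_iSup (fun n => L n ω) n
  have hUw : ∫⁻ ω, U' ω ∂P ≤ w := by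
    have hlim : Tendsto (fun n => w + e₂ n) atTop (𝓝 w) := by
      simpa using he₂.const_add w
    refine ge_of_tendsto' hlim fun n => le_trans ?_ (h₂ n)
    exact lintegral_mono fun ω => iInf_le (fun n => U n ω) n
  have hLU := lintegral_mono_ae (hLV'.trans hVU')
  have hfin : ∫⁻ ω, L' ω ∂P ≠ ∞ := ((hLU.trans hUw).trans_lt hw.lt_top).ne
  -- Supremum and infimum enclose `V`, and their integrals coincide and are finite. They agree
  -- almost everywhere, which makes `V` almost everywhere measurable.
  have hae := ae_eq_of_ae_le_of_lintegral_le (hLV'.trans hVU') hfin hU' (hUw.trans hwL)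
  have hVL : V =ᵐ[P] L' := by
    filter_upwards [hae, hLV', hVU'] with ω h1 h2 h3
    exact le_antisymm (h3.trans h1.ge) h2
  refine ⟨hL'.congr hVL.symm, ?_⟩
  rw [lintegral_congr_ae hVL]
  exact le_antisymm (hLU.trans hUw) hwL

end Operator

/-! ### Almost sure regularity, and values up to the ruin time -/

lemma lintegral_exp_neg_sum {r : ℝ} [IsProbabilityMeasure (expMeasure r)] (n : ℕ) :
    ∫⁻ s, ENNReal.ofReal (Real.exp (-∑ i ∈ Finset.range n, s i)) ∂iidLaw (expMeasure r)
      = (∫⁻ a, ENNReal.ofReal (Real.exp (-a)) ∂expMeasure r) ^ n := by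
  induction n with
  | zero => simp
  | succ n ih =>
    rw [lintegral_iidLaw _ (by fun_prop), pow_succ', ← ih, ← lintegral_mul_const _ (by fun_prop)]
    refine lintegral_congr fun a => ?_
    rw [← lintegral_const_mul _ (by fun_prop)]
    refine lintegral_congr fun s => ?_
    rw [Finset.sum_range_succ', ← ENNReal.ofReal_mul (Real.exp_pos _).le, ← Real.exp_add]
    simp only [seqCons_succ, seqCons_zero]
    congr 2; ring

lemma lintegral_exp_neg_expMeasure {r : ℝ} (hr : 0 < r) :
    ∫⁻ a, ENNReal.ofReal (Real.exp (-a)) ∂expMeasure r = ENNReal.ofReal (r / (r + 1)) := by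
  have h : ∀ x, ENNReal.ofReal (r * Real.exp (-(r * x))) * ENNReal.ofReal (Real.exp (-x))
      = ENNReal.ofReal r * ENNReal.ofReal (Real.exp (-((r + 1) * x))) := fun x => by
    rw [← ENNReal.ofReal_mul (by positivity), ← ENNReal.ofReal_mul hr.le, mul_assoc,
      ← Real.exp_add]
    congr 3; ring
  rw [lintegral_expMeasure r (by fun_prop)]
  simp_rw [h]
  rw [lintegral_const_mul _ (by fun_prop), lintegral_exp_neg (by positivity),
    ← ENNReal.ofReal_mul hr.le, mul_one_div]

/-- Almost surely there are finitely many arrivals in bounded time. -/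
lemma ae_finite_arrivals {r : ℝ} (hr : 0 < r) [IsProbabilityMeasure (expMeasure r)] :
    ∀ᵐ s ∂iidLaw (expMeasure r),
      ∀ t, {n : ℕ | ∑ i ∈ Finset.range (n + 1), s i ≤ t}.Finite := by
  -- With S_n the n-th arrival time, the mean of exp (-S_n) is (r / (r + 1)) ^ n. The geometric
  -- series converges, so almost surely exp (-S_n) tends to `0` and S_n ≤ t holds for finitely many
  -- `n` only.
  have hsum : ∫⁻ s, ∑' n : ℕ, ENNReal.ofReal (Real.exp (-∑ i ∈ Finset.range n, s i))
      ∂iidLaw (expMeasure r) ≠ ∞ := by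
    rw [lintegral_tsum fun n => (by fun_prop)]
    simp_rw [lintegral_exp_neg_sum, lintegral_exp_neg_expMeasure hr]
    rw [ENNReal.tsum_geometric, ENNReal.inv_ne_top]
    refine (tsub_pos_iff_lt.2 ?_).ne'
    rw [ENNReal.ofReal_lt_one, div_lt_one (by positivity)]
    linarith
  filter_upwards [ae_lt_top (Measurable.tsum fun n => by fun_prop) hsum] with s hs t
  have h1 := ENNReal.tendsto_cofinite_zero_of_tsum_ne_top hs.ne
  have h2 := h1.eventually (gt_mem_nhds (show 0 < ENNReal.ofReal (Real.exp (-t)) by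
    simpa using Real.exp_pos _))
  -- The series runs over sums of `n` terms, the set of arrivals over sums of `n + 1` terms.
  have h3 := (eventually_cofinite.1 h2).preimage (f := Nat.succ) Nat.succ_injective.injOn
  refine h3.subset fun n hn => ?_
  have hn' : ∑ i ∈ Finset.range (n + 1), s i ≤ t := hn
  change ¬ ENNReal.ofReal (Real.exp (-∑ i ∈ Finset.range (n + 1), s i))
    < ENNReal.ofReal (Real.exp (-t))
  rw [not_lt]
  exact ENNReal.ofReal_le_ofReal (Real.exp_le_exp.2 (neg_le_neg hn'))

lemma ae_pos_iidLaw (r : ℝ) [IsProbabilityMeasure (expMeasure r)] :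
    ∀ᵐ s ∂iidLaw (expMeasure r), ∀ i, 0 < s i := by
  rw [ae_all_iff]
  intro i
  refine ae_of_ae_map (f := fun s : ℕ → ℝ => s i) (measurable_pi_apply i).aemeasurable ?_
  have : (iidLaw (expMeasure r)).map (fun s => s i) = expMeasure r :=
    Measure.infinitePi_map_eval (fun _ : ℕ => expMeasure r) i
  rw [this]
  exact ae_pos_expMeasure r

lemma ae_regularArrivals {r r' : ℝ} (hr : 0 < r) [IsProbabilityMeasure (expMeasure r)]
    [IsProbabilityMeasure (expMeasure r')] :
    ∀ᵐ c ∂arrivalsLaw (expMeasure r) (expMeasure r'), RegularArrivals c ∧ 0 < c.1 0 := by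
  have h1 := Measure.quasiMeasurePreserving_fst (μ := iidLaw (expMeasure r))
    (ν := iidLaw (expMeasure r'))
  have h2 := Measure.quasiMeasurePreserving_snd (μ := iidLaw (expMeasure r))
    (ν := iidLaw (expMeasure r'))
  filter_upwards [h1.ae (ae_finite_arrivals hr), h1.ae (ae_pos_iidLaw r), h2.ae (ae_pos_iidLaw r')]
    with c hc1 hc2 hc3
  exact ⟨⟨hc1, fun i => (hc2 i).le, fun i => (hc3 i).le⟩, hc2 0⟩

/-- The two sets differ at most in the ruin time itself, where the surplus need not be negative yet.
-/
lemma ae_eq_nonneg_set (X : ℝ → ℝ) :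
    ({t : ℝ | 0 ≤ t ∧ (t : EReal) < ruinTime X} : Set ℝ)
      =ᵐ[volume] ({t : ℝ | 0 ≤ t ∧ ∀ s ∈ Icc 0 t, 0 ≤ X s} : Set ℝ) := by
  have hsub : {t : ℝ | 0 ≤ t ∧ (t : EReal) < ruinTime X}
      ⊆ {t : ℝ | 0 ≤ t ∧ ∀ s ∈ Icc 0 t, 0 ≤ X s} := by
    rintro t ⟨ht, htr⟩
    refine ⟨ht, fun s hs => ?_⟩
    by_contra hX
    have h1 : ruinTime X ≤ (s : EReal) := sInf_le ⟨s, ⟨hs.1, not_le.1 hX⟩, rfl⟩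
    exact (htr.trans_le h1).not_ge (by exact_mod_cast hs.2)
  have hdiff : ∀ t ∈ {t : ℝ | 0 ≤ t ∧ ∀ s ∈ Icc 0 t, 0 ≤ X s} \
      {t : ℝ | 0 ≤ t ∧ (t : EReal) < ruinTime X}, (t : EReal) = ruinTime X := by
    rintro t ⟨⟨ht, htX⟩, htr⟩
    refine le_antisymm ?_ (not_lt.1 fun h => htr ⟨ht, h⟩)
    refine le_sInf ?_
    rintro _ ⟨s, ⟨hs, hsX⟩, rfl⟩
    have : t ≤ s := by
      by_contra hst
      exact hsX.not_ge (htX s ⟨hs, (not_le.1 hst).le⟩)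
    exact EReal.coe_le_coe_iff.2 this
  refine (LE.le.eventuallyLE hsub).antisymm ?_
  rw [ae_le_set]
  refine Set.Subsingleton.measure_zero (fun s hs t ht => ?_) _
  have := (hdiff s hs).trans (hdiff t ht).symm
  exact_mod_cast this

/-- Measurability of the path in time is what links the two integrals: without it the Bochner
integral could be `0` by default. -/
lemma discountedDividends_eq_toReal {δ d b : ℝ} (hd : 0 ≤ d) {X : ℝ → ℝ}
    (hX : AEMeasurable X (volume.restrict (Ici 0))) :
    discountedDividends δ d b X = (pathValue δ d b X).toReal := by
  set D : Set ℝ := {t : ℝ | 0 ≤ t ∧ ∀ s ∈ Icc 0 t, 0 ≤ X s} with hD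
  -- `D` is an interval, whatever the path looks like.
  have hDm : MeasurableSet D := by
    refine OrdConnected.measurableSet ⟨fun s hs t ht u hu => ⟨hs.1.trans hu.1, fun r hr => ?_⟩⟩
    exact ht.2 r ⟨hr.1, hr.2.trans hu.2⟩
  have hDI : D ⊆ Ici 0 := fun t ht => ht.1
  have hpv : pathValue δ d b X = ∫⁻ t in D, ENNReal.ofReal
      (Real.exp (-δ * t) * dividendRate d b (X t)) := by
    rw [pathValue, ← lintegral_indicator measurableSet_Ici, ← lintegral_indicator hDm]
    refine lintegral_congr fun t => ?_
    by_cases ht : 0 ≤ t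
    · rw [indicator_of_mem (show t ∈ Ici 0 from ht)]
      by_cases hs : ∀ s ∈ Icc 0 t, 0 ≤ X s
      · rw [indicator_of_mem (show t ∈ {t : ℝ | ∀ s ∈ Icc 0 t, 0 ≤ X s} from hs),
          indicator_of_mem (show t ∈ D from ⟨ht, hs⟩), neg_mul]
      · rw [indicator_of_notMem (show t ∉ {t : ℝ | ∀ s ∈ Icc 0 t, 0 ≤ X s} from hs),
          indicator_of_notMem (show t ∉ D from fun h => hs h.2)]
    · rw [indicator_of_notMem (show t ∉ Ici 0 from ht),
        indicator_of_notMem (show t ∉ D from fun h => ht h.1)]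
  rw [discountedDividends, setIntegral_congr_set (ae_eq_nonneg_set X), ← hD, hpv]
  refine integral_eq_lintegral_of_nonneg_ae (Eventually.of_forall fun t =>
    mul_nonneg (Real.exp_pos _).le (dividendRate_nonneg hd b _)) ?_
  have h1 := (measurable_dividendRate d b).comp_aemeasurable
    (hX.mono_measure (Measure.restrict_mono hDI le_rfl))
  exact ((Measurable.aemeasurable (by fun_prop)).mul h1).aestronglyMeasurable

/-! ### The expected dividends equal the candidate -/

section Model

variable {Ω : Type*} [MeasurableSpace Ω] {P : Measure Ω} [IsProbabilityMeasure P]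
  {lam lamb mu mub b d δ : ℝ} {T Y Tb Yb : ℕ → Ω → ℝ} {C z a c : Fin 4 → ℝ} {X : ℝ → Ω → ℝ}

/-- The arrivals of claims and premiums at an elementary event. -/
def arrivals (T Y Tb Yb : ℕ → Ω → ℝ) (ω : Ω) : Arrivals × Arrivals :=
  ((fun i => T i ω, fun i => Y i ω), (fun i => Tb i ω, fun i => Yb i ω))

lemma ae_admissiblePath (hlam : 0 < lam) (hlamb : 0 < lamb) (hmu : 0 < mu) (hmub : 0 < mub)
    (hmodel : ExpRiskModel P lam lamb mu mub T Y Tb Yb) {x : ℝ}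
    (hX : IsThresholdSurplus P d b T Y Tb Yb x X) :
    ∀ᵐ ω ∂P, AdmissiblePath d b (x, arrivals T Y Tb Yb ω) (fun t => X t ω) := by
  have := isProbabilityMeasure_expMeasure hlam
  have := isProbabilityMeasure_expMeasure hlamb
  have := isProbabilityMeasure_expMeasure (one_div_pos.2 hmu)
  have := isProbabilityMeasure_expMeasure (one_div_pos.2 hmub)
  have h1 : ∀ᵐ z ∂P.map (arrivals T Y Tb Yb),
      (RegularArrivals z.1 ∧ 0 < z.1.1 0) ∧ RegularArrivals z.2 ∧ 0 < z.2.1 0 := by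
    have h2 : P.map (arrivals T Y Tb Yb) = _ := map_arrivals hmodel
    rw [h2]
    filter_upwards [Measure.quasiMeasurePreserving_fst.ae (ae_regularArrivals hlam),
      Measure.quasiMeasurePreserving_snd.ae (ae_regularArrivals hlamb)] with z h3 h4
    exact ⟨h3, h4⟩
  filter_upwards [ae_of_ae_map (aemeasurable_arrivals hmodel) h1, hX] with ω h3 h4
  exact ⟨h4, h3.1.1, h3.2.1, fun _ => h3.2.2⟩

/-- The path value lies between the iterates from `0` and from `d / δ`. Their means are iterates of
`renewalOp`, within ρ ^ n times a constant of the fixed point on the relevant side, so the squeeze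
applies. -/
lemma SystemSolution.integrable_and_expectedDividends
    (h : SystemSolution lam lamb mu mub b d δ (d / δ) C z a c) (hlam : 0 < lam) (hlamb : 0 < lamb)
    (hmu : 0 < mu) (hmub : 0 < mub) (hb : 0 < b) (hd : 0 < d) (hδ : 0 < δ)
    (hmodel : ExpRiskModel P lam lamb mu mub T Y Tb Yb) {x : ℝ}
    (hX : IsThresholdSurplus P d b T Y Tb Yb x X) :
    Integrable (fun ω => discountedDividends δ d b (fun t => X t ω)) P ∧
      expectedDividends P δ d b X = candidate b (d / δ) C z x := by
  have := isProbabilityMeasure_expMeasure hlam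
  have := isProbabilityMeasure_expMeasure hlamb
  have := isProbabilityMeasure_expMeasure (one_div_pos.2 hmu)
  have := isProbabilityMeasure_expMeasure (one_div_pos.2 hmub)
  have hadm := ae_admissiblePath hlam hlamb hmu hmub hmodel hX
  obtain ⟨M, hM⟩ := exists_candidate_bound (b := b) (q := d / δ) (C := C) h.neg_two h.neg_three
  have hnn := h.candidate_nonneg hlam hlamb hmu hmub hb hd hδ (by positivity)
  set K := renewalOp δ d b lam lamb (expMeasure (1 / mu)) (expMeasure (1 / mub)) with hK
  set w : ℝ → ℝ≥0∞ := fun x => ENNReal.ofReal (candidate b (d / δ) C z x) with hw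
  have hfix : ∀ n, K^[n] w = w := fun n =>
    Function.iterate_fixed (h.renewalOp_candidate hlam hlamb hmu hmub hb hd hδ) n
  have hmean : ∀ (e : ℝ≥0∞) (n : ℕ),
      ∫⁻ ω, (renewalStep δ d b)^[n] (fun _ => e) (x, arrivals T Y Tb Yb ω) ∂P
        = K^[n] (fun _ => e) x := by
    intro e n
    have hm := (measurable_iterate_renewalStep (δ := δ) (d := d) (b := b) e n)
    have hm' : Measurable fun z : Arrivals × Arrivals =>
      (renewalStep δ d b)^[n] (fun _ => e) (x, z) := by fun_prop
    have h2 : P.map (arrivals T Y Tb Yb) = _ := map_arrivals hmodel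
    rw [← lintegral_map' (f := fun z => (renewalStep δ d b)^[n] (fun _ => e) (x, z))
      (g := arrivals T Y Tb Yb) hm'.aemeasurable (aemeasurable_arrivals hmodel), h2,
      lintegral_prod _ hm'.aemeasurable, hK, ← meanValue_iterate hlam hlamb e n, meanValue]
  have haem : ∀ (e : ℝ≥0∞) (n : ℕ), AEMeasurable
      (fun ω => (renewalStep δ d b)^[n] (fun _ => e) (x, arrivals T Y Tb Yb ω)) P := by
    intro e n
    have hm := (measurable_iterate_renewalStep (δ := δ) (d := d) (b := b) e n)
    exact Measurable.comp_aemeasurable (g := fun z : Arrivals × Arrivals =>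
      (renewalStep δ d b)^[n] (fun _ => e) (x, z)) (by fun_prop) (aemeasurable_arrivals hmodel)
  set ρ := (lam + lamb) / (lam + lamb + δ) with hρ
  have hρ1 : ρ < 1 := by rw [hρ, div_lt_one (by positivity)]; linarith
  have hlow : ∀ n : ℕ, w x ≤ K^[n] (fun _ => 0) x + ENNReal.ofReal ρ ^ n * ENNReal.ofReal M := by
    intro n
    have := iterate_renewalOp_le_add (d := d) (b := b) (ν := expMeasure (1 / mu))
      (ν' := expMeasure (1 / mub)) hlam hlamb hδ (u := w) (v := fun _ => 0) (ε := ENNReal.ofReal M)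
      (fun x => by
        rw [zero_add]
        exact ENNReal.ofReal_le_ofReal ((le_abs_self _).trans (hM x))) n x
    rwa [← hK, hfix n] at this
  have hupp : ∀ n : ℕ, K^[n] (fun _ => ENNReal.ofReal (d / δ)) x
      ≤ w x + ENNReal.ofReal ρ ^ n * ENNReal.ofReal (d / δ) := by
    intro n
    have := iterate_renewalOp_le_add (d := d) (b := b) (ν := expMeasure (1 / mu))
      (ν' := expMeasure (1 / mub)) hlam hlamb hδ (u := fun _ => ENNReal.ofReal (d / δ)) (v := w)
      (ε := ENNReal.ofReal (d / δ)) (fun x => le_add_self) n x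
    rwa [← hK, hfix n] at this
  have hlim : ∀ e : ℝ, Tendsto (fun n : ℕ => ENNReal.ofReal ρ ^ n * ENNReal.ofReal e) atTop
      (𝓝 0) := fun e => tendsto_ofReal_pow_mul hρ1 ENNReal.ofReal_ne_top
  obtain ⟨hVm, hV⟩ := lintegral_eq_of_sandwich (P := P)
    (V := fun ω => pathValue δ d b fun t => X t ω)
    (haem 0) (haem (ENNReal.ofReal (d / δ)))
    (by filter_upwards [hadm] with ω hω n using hω.iterate_renewalStep_zero_le hd hb.le n)
    (by filter_upwards [hadm] with ω hω n using hω.le_iterate_renewalStep hd hb.le hδ n)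
    (w := w x) ENNReal.ofReal_ne_top
    (fun n => by rw [hmean]; exact hlow n) (fun n => by rw [hmean]; exact hupp n)
    (hlim M) (hlim (d / δ))
  have hae : (fun ω => discountedDividends δ d b (fun t => X t ω))
      =ᵐ[P] fun ω => (pathValue δ d b fun t => X t ω).toReal := by
    filter_upwards [hadm] with ω hω
    exact discountedDividends_eq_toReal hd.le (hω.path.aemeasurable hd.le hω.claims hω.premiums)
  constructor
  · refine (integrable_congr hae).2 (integrable_toReal_of_lintegral_ne_top hVm ?_)
    rw [hV]
    exact ENNReal.ofReal_ne_top
  · rw [expectedDividends, integral_congr_ae hae, integral_toReal hVm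
      (Eventually.of_forall fun ω => (pathValue_le hd.le hδ _).trans_lt ENNReal.ofReal_lt_top), hV,
      hw, ENNReal.toReal_ofReal (hnn x)]

end Model

/-! ### The characteristic roots -/

section Roots

variable {lam lamb mu mub b d δ : ℝ}

lemma quadratic_of_sqrt {K G s z δ : ℝ} (hK : K ≠ 0) (hs : s ^ 2 = G ^ 2 + 4 * δ * K)
    (hz : z = (-G + s) / (2 * K)) : K * z ^ 2 + G * z - δ = 0 := by
  have h : 2 * K * z = -G + s := by rw [hz]; field_simp
  have h2 : 4 * K * (K * z ^ 2 + G * z - δ) = 0 := by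
    linear_combination (2 * K * z + G + s) * h + hs
  exact (mul_eq_zero.1 h2).resolve_left (by simpa using hK)

lemma discD3_pos (hlam : 0 < lam) (hlamb : 0 < lamb) (hmu : 0 < mu) (hmub : 0 < mub)
    (hδ : 0 < δ) : 0 < discD3 lam lamb mu mub δ := by
  unfold discD3; positivity

lemma quadratic_root9 (hlam : 0 < lam) (hlamb : 0 < lamb) (hmu : 0 < mu) (hmub : 0 < mub)
    (hδ : 0 < δ) {z : ℝ} (hz : z = root9 lam lamb mu mub δ) :
    mu * mub * (lam + lamb + δ) * z ^ 2 + (mub * (lamb + δ) - mu * (lam + δ)) * z - δ = 0 := by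
  refine quadratic_of_sqrt (s := Real.sqrt (discD3 lam lamb mu mub δ)) (by positivity) ?_ ?_
  · rw [Real.sq_sqrt (discD3_pos hlam hlamb hmu hmub hδ).le, discD3]
    ring
  · rw [hz, root9]
    congr 1; ring

lemma quadratic_root10 (hlam : 0 < lam) (hlamb : 0 < lamb) (hmu : 0 < mu) (hmub : 0 < mub)
    (hδ : 0 < δ) {z : ℝ} (hz : z = root10 lam lamb mu mub δ) :
    mu * mub * (lam + lamb + δ) * z ^ 2 + (mub * (lamb + δ) - mu * (lam + δ)) * z - δ = 0 := by
  refine quadratic_of_sqrt (s := -Real.sqrt (discD3 lam lamb mu mub δ)) (by positivity) ?_ ?_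
  · rw [neg_sq, Real.sq_sqrt (discD3_pos hlam hlamb hmu hmub hδ).le, discD3]
    ring
  · rw [hz, root10]
    congr 1; ring

lemma root9_ne_root10 (hlam : 0 < lam) (hlamb : 0 < lamb) (hmu : 0 < mu) (hmub : 0 < mub)
    (hδ : 0 < δ) : root9 lam lamb mu mub δ ≠ root10 lam lamb mu mub δ := by
  unfold root9 root10
  have h := Real.sqrt_pos.2 (discD3_pos hlam hlamb hmu hmub hδ)
  have hK : 2 * mu * mub * (lam + lamb + δ) ≠ 0 := by positivity
  rw [Ne, div_left_inj' hK]
  intro h'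
  linarith

/-- The characteristic equation at exponent `z`, for drift `-e`. -/
def CharEq (lam lamb mu mub δ e z : ℝ) : Prop :=
  lam * (1 - mub * z) + lamb * (1 + mu * z)
    = (lam + lamb + δ + e * z) * ((1 + mu * z) * (1 - mub * z))

lemma charEq_of_quadratic {z : ℝ}
    (h : mu * mub * (lam + lamb + δ) * z ^ 2 + (mub * (lamb + δ) - mu * (lam + δ)) * z - δ = 0) :
    CharEq lam lamb mu mub δ 0 z := by
  unfold CharEq; linear_combination h

lemma charEq_of_cubic {z : ℝ} (h : dividendCubic lam lamb mu mub d δ z = 0) :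
    CharEq lam lamb mu mub δ d z := by
  unfold CharEq; unfold dividendCubic at h; linear_combination h

/-- At z = -1 / mu the equation reduces to lam * (1 - mub * z) = 0, which would force z = 1 / mub >
0. -/
lemma CharEq.claim_ne {e z : ℝ} (h : CharEq lam lamb mu mub δ e z) (hlam : 0 < lam)
    (hmu : 0 < mu) (hmub : 0 < mub) : 1 + mu * z ≠ 0 := by
  intro h0
  have h1 : lam * (1 - mub * z) = 0 := by
    unfold CharEq at h
    linear_combination h + (-lamb + (lam + lamb + δ + e * z) * (1 - mub * z)) * h0
  have h2 : 1 - mub * z = 0 := (mul_eq_zero.1 h1).resolve_left hlam.ne'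
  have h3 : mub + mu = 0 := by linear_combination mub * h0 + mu * h2
  linarith

/-- For z ≥ 1 / mub all terms, brought to one side, are nonnegative and one is positive. -/
lemma CharEq.premium_lt {z : ℝ} (h : CharEq lam lamb mu mub δ 0 z) (hlam : 0 < lam)
    (hlamb : 0 < lamb) (hmu : 0 < mu) (hmub : 0 < mub) (hδ : 0 < δ) : mub * z < 1 := by
  by_contra hz
  have hs : 0 ≤ mub * z - 1 := by linarith
  have hz0 : 0 < z := pos_of_mul_pos_right (by linarith : 0 < mub * z) hmub.le
  have hm : 0 < mu * z := mul_pos hmu hz0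
  unfold CharEq at h
  have h1 : lamb * (1 + mu * z)
      + (mub * z - 1) * (lamb + δ + (lam + lamb + δ) * (mu * z)) = 0 := by linear_combination h
  have h2 : 0 ≤ (mub * z - 1) * (lamb + δ + (lam + lamb + δ) * (mu * z)) :=
    mul_nonneg hs (by positivity)
  have h3 : 0 < lamb * (1 + mu * z) := by positivity
  linarith

lemma CharEq.sum_inv {e z : ℝ} (h : CharEq lam lamb mu mub δ e z) (h1 : 1 + mu * z ≠ 0)
    (h2 : 1 - mub * z ≠ 0) :
    lam * (1 + mu * z)⁻¹ + lamb * (1 - mub * z)⁻¹ = lam + lamb + δ + e * z := by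
  unfold CharEq at h
  have ha := inv_mul_cancel₀ h1
  have hc := inv_mul_cancel₀ h2
  linear_combination (1 + mu * z)⁻¹ * (1 - mub * z)⁻¹ * h - lam * (1 + mu * z)⁻¹ * hc
    - lamb * (1 - mub * z)⁻¹ * ha
    + (lam + lamb + δ + e * z) * ((1 - mub * z)⁻¹ * (1 - mub * z) * ha + hc)

lemma continuous_dividendCubic : Continuous (dividendCubic lam lamb mu mub d δ) := by
  unfold dividendCubic; fun_prop

/-- The cubic is negative far to the left, equals λ + λ μ̄ / μ > 0 at -1 / μ, equals -δ < 0 at 0,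
and equals λ̄ + λ̄ μ / μ̄ > 0 at 1 / μ̄. Each sign change gives a root. -/
lemma exists_three_roots (hlam : 0 < lam) (hlamb : 0 < lamb) (hmu : 0 < mu) (hmub : 0 < mub)
    (hd : 0 < d) (hδ : 0 < δ) :
    ∃ r₁ r₂ r₃, r₁ < r₂ ∧ r₂ < 0 ∧ 0 < r₃ ∧ dividendCubic lam lamb mu mub d δ r₁ = 0 ∧
      dividendCubic lam lamb mu mub d δ r₂ = 0 ∧ dividendCubic lam lamb mu mub d δ r₃ = 0 := by
  set f := dividendCubic lam lamb mu mub d δ with hf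
  have hcont : Continuous f := continuous_dividendCubic
  set K := d * mu * mub with hK
  set B := d * (mub - mu) + mu * mub * (lam + lamb + δ) with hB
  set G := mub * (lamb + δ) - mu * (lam + δ) - d with hG
  have hK0 : 0 < K := by positivity
  have hfe : ∀ z, f z = K * z ^ 3 + B * z ^ 2 + G * z - δ := fun z => rfl
  have hm1 : 0 < f (-(1 / mu)) := by
    have : f (-(1 / mu)) = lam + lam * mub / mu := by
      rw [hfe, hK, hB, hG]; field_simp; ring
    rw [this]; positivity
  have h0 : f 0 < 0 := by rw [hfe]; simpa using hδ
  have hp1 : 0 < f (1 / mub) := by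
    have : f (1 / mub) = lamb + lamb * mu / mub := by
      rw [hfe, hK, hB, hG]; field_simp; ring
    rw [this]; positivity
  -- Chosen so that `-n` lies to the left of `-(1 / mu)`, and `n ≥ 1` with `K * n ≥ K + |B| + |G|`
  -- lets the cubic term dominate.
  set n := 1 + 1 / mu + (|B| + |G|) / K with hn
  have hn1 : 1 ≤ n := by
    have : 0 ≤ 1 / mu + (|B| + |G|) / K := by positivity
    linarith
  have hKn : K + |B| + |G| ≤ K * n := by
    have h1 : K * n = K + K * (1 / mu) + (|B| + |G|) := by rw [hn]; field_simp
    have h2 : 0 < K * (1 / mu) := by positivity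
    linarith
  have hneg : f (-n) < 0 := by
    have e : f (-n) = -(K * n) * n ^ 2 + B * n ^ 2 - G * n - δ := by rw [hfe]; ring
    have h1 : (K + |B| + |G|) * n ^ 2 ≤ K * n * n ^ 2 := by gcongr
    have h2 : B * n ^ 2 ≤ |B| * n ^ 2 := by gcongr; exact le_abs_self B
    have h3 : -G * n ≤ |G| * n ^ 2 :=
      mul_le_mul (neg_le_abs G) (le_self_pow₀ hn1 two_ne_zero) (by linarith) (abs_nonneg G)
    have h4 : 0 < K * n ^ 2 := by positivity
    rw [e]
    linarith
  have hnm : -n < -(1 / mu) := by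
    have : 0 ≤ (|B| + |G|) / K := by positivity
    linarith
  have hm0 : -(1 / mu) < 0 := by simpa using hmu
  have hp0 : 0 < 1 / mub := by positivity
  obtain ⟨r₁, hr₁, hf₁⟩ := intermediate_value_Ioo hnm.le hcont.continuousOn ⟨hneg, hm1⟩
  obtain ⟨r₂, hr₂, hf₂⟩ := intermediate_value_Ioo' hm0.le hcont.continuousOn ⟨h0, hm1⟩
  obtain ⟨r₃, hr₃, hf₃⟩ := intermediate_value_Ioo hp0.le hcont.continuousOn ⟨h0, hp1⟩
  exact ⟨r₁, r₂, r₃, hr₁.2.trans hr₂.1, hr₂.2, hr₃.1, hf₁, hf₂, hf₃⟩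

/-- Dividing out r₁ and r₂ leaves the linear factor K (x + r₁ + r₂) + B, which cannot vanish at both
`z` and r₃. -/
lemma eq_of_cubic_roots {K B G e r₁ r₂ r₃ z : ℝ} (hK : K ≠ 0) (h12 : r₁ ≠ r₂) (h13 : r₁ ≠ r₃)
    (h23 : r₂ ≠ r₃) (h₁ : K * r₁ ^ 3 + B * r₁ ^ 2 + G * r₁ - e = 0)
    (h₂ : K * r₂ ^ 3 + B * r₂ ^ 2 + G * r₂ - e = 0) (h₃ : K * r₃ ^ 3 + B * r₃ ^ 2 + G * r₃ - e = 0)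
    (hz : K * z ^ 3 + B * z ^ 2 + G * z - e = 0) : z = r₁ ∨ z = r₂ ∨ z = r₃ := by
  by_contra! hne
  obtain ⟨hz1, hz2, hz3⟩ := hne
  have key : ∀ x, x ≠ r₁ → x ≠ r₂ → K * x ^ 3 + B * x ^ 2 + G * x - e = 0 →
      K * (x + r₁ + r₂) + B = 0 := by
    intro x hx1 hx2 hx
    have e1 : K * (x ^ 2 + x * r₁ + r₁ ^ 2) + B * (x + r₁) + G = 0 := by
      refine (mul_eq_zero.1 ?_).resolve_left (sub_ne_zero.2 hx1)
      linear_combination hx - h₁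
    have e2 : K * (r₂ ^ 2 + r₂ * r₁ + r₁ ^ 2) + B * (r₂ + r₁) + G = 0 := by
      refine (mul_eq_zero.1 ?_).resolve_left (sub_ne_zero.2 h12.symm)
      linear_combination h₂ - h₁
    refine (mul_eq_zero.1 ?_).resolve_left (sub_ne_zero.2 hx2)
    linear_combination e1 - e2
  have e3 := key z hz1 hz2 hz
  have e4 := key r₃ h13.symm h23.symm h₃
  have e5 : K * (z - r₃) = 0 := by linear_combination e3 - e4
  exact (mul_ne_zero hK (sub_ne_zero.2 hz3)) e5

lemma ncard_neg_roots (hlam : 0 < lam) (hlamb : 0 < lamb) (hmu : 0 < mu) (hmub : 0 < mub)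
    (hd : 0 < d) (hδ : 0 < δ) :
    {z : ℝ | z < 0 ∧ dividendCubic lam lamb mu mub d δ z = 0}.ncard = 2 := by
  obtain ⟨r₁, r₂, r₃, h12, h2, h3, hf₁, hf₂, hf₃⟩ :=
    exists_three_roots hlam hlamb hmu hmub hd hδ
  have hset : {z : ℝ | z < 0 ∧ dividendCubic lam lamb mu mub d δ z = 0} = {r₁, r₂} := by
    ext z
    simp only [mem_ofPred_eq, mem_insert_iff, mem_singleton_iff]
    constructor
    · rintro ⟨hz, hfz⟩
      rcases eq_of_cubic_roots (K := d * mu * mub) (by positivity) h12.ne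
        (h12.trans (h2.trans h3)).ne (h2.trans h3).ne hf₁ hf₂ hf₃ hfz with h | h | h
      · exact Or.inl h
      · exact Or.inr h
      · exact absurd hz (by rw [h]; exact h3.not_gt)
    · rintro (rfl | rfl)
      · exact ⟨h12.trans h2, hf₁⟩
      · exact ⟨h2, hf₂⟩
  rw [hset, ncard_pair h12.ne]

end Roots

/-! ### The linear system -/

section System

variable {lam lamb mu mub b d δ q z9 z10 z11 z12 : ℝ}

/-- A solution of the linear system, as a system in terms of Laplace transforms. -/
lemma systemSolution_of_mulVec (hlam : 0 < lam) (hlamb : 0 < lamb) (hmu : 0 < mu)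
    (hmub : 0 < mub) (hδ : 0 < δ)
    (h9 : CharEq lam lamb mu mub δ 0 z9) (h10 : CharEq lam lamb mu mub δ 0 z10)
    (h11 : CharEq lam lamb mu mub δ d z11) (h12 : CharEq lam lamb mu mub δ d z12)
    (hz11 : z11 < 0) (hz12 : z12 < 0) {C : Fin 4 → ℝ}
    (hC : systemMatrix lam lamb mu mub b d δ z9 z10 z11 z12 *ᵥ C
      = ![lamb * q, 0, q, -(lam * q)]) :
    SystemSolution lam lamb mu mub b d δ q C ![z9, z10, z11, z12]
      (fun i => (1 + mu * ![z9, z10, z11, z12] i)⁻¹)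
      (fun i => (1 - mub * ![z9, z10, z11, z12] i)⁻¹) := by
  have r0 := congrFun hC 0
  have r1 := congrFun hC 1
  have r2 := congrFun hC 2
  have r3 := congrFun hC 3
  simp [systemMatrix, Matrix.mulVec, dotProduct, Fin.sum_univ_four] at r0 r1 r2 r3
  have p9 := h9.premium_lt hlam hlamb hmu hmub hδ
  have p10 := h10.premium_lt hlam hlamb hmu hmub hδ
  have p11 : mub * z11 < 1 := (mul_neg_of_pos_of_neg hmub hz11).trans one_pos
  have p12 : mub * z12 < 1 := (mul_neg_of_pos_of_neg hmub hz12).trans one_pos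
  have c9 := h9.claim_ne hlam hmu hmub
  have c10 := h10.claim_ne hlam hmu hmub
  have c11 := h11.claim_ne hlam hmu hmub
  have c12 := h12.claim_ne hlam hmu hmub
  have s9 := h9.sum_inv c9 (sub_pos.2 p9).ne'
  have s10 := h10.sum_inv c10 (sub_pos.2 p10).ne'
  have s11 := h11.sum_inv c11 (sub_pos.2 p11).ne'
  have s12 := h12.sum_inv c12 (sub_pos.2 p12).ne'
  have hinv : ∀ z k : ℝ, k / (mub * z - 1) = -(k * (1 - mub * z)⁻¹) := fun z k => by
    rw [← neg_sub 1 (mub * z), div_neg, div_eq_mul_inv]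
  have hinv' : ∀ z : ℝ, lam / (mu * z + 1) = lam * (1 + mu * z)⁻¹ := fun z => by
    rw [add_comm, div_eq_mul_inv]
  -- The characteristic equation turns the second row into a positive multiple of `claims_zero`.
  have hrow : ∀ z, CharEq lam lamb mu mub δ 0 z → 1 + mu * z ≠ 0 →
      lam + δ + lam * mub / mu - mub * z * (lam + lamb + δ)
        = (lam + lam * mub / mu) * (1 + mu * z)⁻¹ := by
    intro z hz h1
    unfold CharEq at hz
    field_simp
    linear_combination -mu * hz
  rw [hrow _ h9 c9, hrow _ h10 c10] at r1
  simp only [hinv, hinv'] at r0 r3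
  have hk : lam + lam * mub / mu ≠ 0 := by positivity
  have hcl : C 0 * (1 + mu * z9)⁻¹ + C 1 * (1 + mu * z10)⁻¹ = 0 := by
    refine (mul_eq_zero.1 ?_).resolve_left hk
    linear_combination r1
  refine
    { claim_inv := fun i => inv_mul_cancel₀ ?_
      premium_inv := fun i => inv_mul_cancel₀ ?_
      premium_lt := fun i => ?_
      neg_two := hz11
      neg_three := hz12
      char_zero := s9.trans (by ring)
      char_one := s10.trans (by ring)
      char_two := s11
      char_three := s12
      claims_zero := hcl
      premiums := sub_eq_zero.1 ((mul_eq_zero.1 ?_).resolve_left hlamb.ne')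
      continuity := ?_
      claims := sub_eq_zero.1 ((mul_eq_zero.1 ?_).resolve_left hlam.ne') }
  · fin_cases i
    exacts [c9, c10, c11, c12]
  · fin_cases i
    exacts [(sub_pos.2 p9).ne', (sub_pos.2 p10).ne', (sub_pos.2 p11).ne', (sub_pos.2 p12).ne']
  · fin_cases i
    exacts [p9, p10, p11, p12]
  · simp only [Matrix.cons_val]
    -- In the first row, A is replaced through the characteristic equation: the premium part cancels
    -- the terms in exp (b / mub), and the claim part vanishes by `hcl`.
    linear_combination r0 + Real.exp (b / mub) * C 0 * s9 + Real.exp (b / mub) * C 1 * s10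
      - Real.exp (b / mub) * lam * hcl
  · simp only [Matrix.cons_val]
    linear_combination r2
  · simp only [Matrix.cons_val]
    -- In the last row, `hcl` removes the terms in exp (-b / mu), and above the threshold the
    -- characteristic equation leaves only the claim transform.
    linear_combination -r3 + lam * Real.exp (-b / mu) * hcl - Real.exp (z11 * b) * C 2 * s11
      - Real.exp (z12 * b) * C 3 * s12

/-- A kernel vector would be a nonzero solution with `q = 0`, which the vanishing of the candidate
without dividends excludes. -/
lemma det_systemMatrix_ne_zero (hlam : 0 < lam) (hlamb : 0 < lamb) (hmu : 0 < mu)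
    (hmub : 0 < mub) (hb : 0 < b) (hd : 0 < d) (hδ : 0 < δ)
    (h9 : CharEq lam lamb mu mub δ 0 z9) (h10 : CharEq lam lamb mu mub δ 0 z10)
    (h11 : CharEq lam lamb mu mub δ d z11) (h12 : CharEq lam lamb mu mub δ d z12)
    (hz11 : z11 < 0) (hz12 : z12 < 0) (hlow : z9 ≠ z10) (hhigh : z11 ≠ z12) :
    (systemMatrix lam lamb mu mub b d δ z9 z10 z11 z12).det ≠ 0 := by
  intro hdet
  obtain ⟨C, hC0, hC⟩ := Matrix.exists_mulVec_eq_zero_iff.2 hdet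
  refine hC0 ?_
  have hC' : systemMatrix lam lamb mu mub b d δ z9 z10 z11 z12 *ᵥ C
      = ![lamb * 0, 0, 0, -(lam * 0)] := by
    rw [hC]
    funext i
    fin_cases i <;> simp
  exact (systemSolution_of_mulVec hlam hlamb hmu hmub hδ h9 h10 h11 h12 hz11 hz12 hC').eq_zero
    hlam hlamb hmu hmub hb hd hδ hlow hhigh

lemma exists_systemSolution (hlam : 0 < lam) (hlamb : 0 < lamb) (hmu : 0 < mu)
    (hmub : 0 < mub) (hb : 0 < b) (hd : 0 < d) (hδ : 0 < δ)
    (hz9 : z9 = root9 lam lamb mu mub δ) (hz10 : z10 = root10 lam lamb mu mub δ)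
    (hz11 : z11 < 0) (hz12 : z12 < 0) (hhigh : z11 ≠ z12)
    (h11 : dividendCubic lam lamb mu mub d δ z11 = 0)
    (h12 : dividendCubic lam lamb mu mub d δ z12 = 0) :
    ∃ C a c, SystemSolution lam lamb mu mub b d δ (d / δ) C ![z9, z10, z11, z12] a c ∧
      systemMatrix lam lamb mu mub b d δ z9 z10 z11 z12 *ᵥ C = systemRHS lam lamb d δ := by
  have h9 := charEq_of_quadratic (quadratic_root9 hlam hlamb hmu hmub hδ hz9)
  have h10 := charEq_of_quadratic (quadratic_root10 hlam hlamb hmu hmub hδ hz10)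
  have hdet := det_systemMatrix_ne_zero hlam hlamb hmu hmub hb hd hδ h9 h10
    (charEq_of_cubic h11) (charEq_of_cubic h12) hz11 hz12
    (by rw [hz9, hz10]; exact root9_ne_root10 hlam hlamb hmu hmub hδ) hhigh
  have hC : systemMatrix lam lamb mu mub b d δ z9 z10 z11 z12 *ᵥ
      ((systemMatrix lam lamb mu mub b d δ z9 z10 z11 z12)⁻¹ *ᵥ systemRHS lam lamb d δ)
      = systemRHS lam lamb d δ := by
    rw [Matrix.mulVec_mulVec, Matrix.mul_nonsing_inv _ (isUnit_iff_ne_zero.2 hdet),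
      Matrix.one_mulVec]
  refine ⟨_, _, _, systemSolution_of_mulVec hlam hlamb hmu hmub hδ h9 h10 (charEq_of_cubic h11)
    (charEq_of_cubic h12) hz11 hz12 (q := d / δ) ?_, hC⟩
  rw [hC, systemRHS]
  funext i
  fin_cases i <;> simp <;> ring

end System

end ThresholdDividends

/-! ### The theorem -/

theorem theorem5 {Ω : Type*} [MeasurableSpace Ω] (P : Measure Ω) [IsProbabilityMeasure P]
    (lam lamb mu mub b d δ : ℝ) (hlam : 0 < lam) (hlamb : 0 < lamb) (hmu : 0 < mu)
    (hmub : 0 < mub) (hb : 0 < b) (hd : 0 < d) (hδ : 0 < δ)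
    (T Y Tb Yb : ℕ → Ω → ℝ) (hmodel : ExpRiskModel P lam lamb mu mub T Y Tb Yb)
    (X : ℝ → ℝ → Ω → ℝ)
    (hX : ∀ x : ℝ, 0 ≤ x → IsThresholdSurplus P d b T Y Tb Yb x (X x))
    (hprofit : lam * mu + d < lamb * mub)
    (hD4 : 0 < discD4 lam lamb mu mub d δ) :
    (∀ x : ℝ, 0 ≤ x →
      Integrable (fun ω => discountedDividends δ d b (fun t => X x t ω)) P) ∧
    {z : ℝ | z < 0 ∧ dividendCubic lam lamb mu mub d δ z = 0}.ncard = 2 ∧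
    ∀ z9 z10 z11 z12 : ℝ,
      z9 = root9 lam lamb mu mub δ → z10 = root10 lam lamb mu mub δ →
      z11 < 0 → z12 < 0 → z11 ≠ z12 →
      dividendCubic lam lamb mu mub d δ z11 = 0 → dividendCubic lam lamb mu mub d δ z12 = 0 →
      ∃ C9 C10 C11 C12 : ℝ,
        (∀ x : ℝ, 0 ≤ x → x ≤ b →
          expectedDividends P δ d b (X x)
            = C9 * Real.exp (z9 * x) + C10 * Real.exp (z10 * x)) ∧
        (∀ x : ℝ, b ≤ x →
          expectedDividends P δ d b (X x)
            = C11 * Real.exp (z11 * x) + C12 * Real.exp (z12 * x) + d / δ) ∧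
        systemMatrix lam lamb mu mub b d δ z9 z10 z11 z12 *ᵥ ![C9, C10, C11, C12]
          = systemRHS lam lamb d δ ∧
        ((systemMatrix lam lamb mu mub b d δ z9 z10 z11 z12).det ≠ 0 →
          ∀ C : Fin 4 → ℝ,
            systemMatrix lam lamb mu mub b d δ z9 z10 z11 z12 *ᵥ C = systemRHS lam lamb d δ →
            C = ![C9, C10, C11, C12]) := by
  refine ⟨fun x hx => ?_, ThresholdDividends.ncard_neg_roots hlam hlamb hmu hmub hd hδ, ?_⟩
  -- Integrability does not mention the roots, so a pair of negative roots has to be supplied.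
  · obtain ⟨z11, z12, -, h12, h2, -, hf1, hf2, -⟩ :=
      ThresholdDividends.exists_three_roots hlam hlamb hmu hmub hd hδ
    obtain ⟨C, a, c, h, -⟩ := ThresholdDividends.exists_systemSolution hlam hlamb hmu hmub hb hd hδ
      rfl rfl (h12.trans h2) h2 h12.ne hf1 hf2
    exact (h.integrable_and_expectedDividends hlam hlamb hmu hmub hb hd hδ hmodel (hX x hx)).1
  · intro z9 z10 z11 z12 hz9 hz10 hz11 hz12 hne h11 h12
    obtain ⟨C, a, c, h, hC⟩ := ThresholdDividends.exists_systemSolution hlam hlamb hmu hmub hb hd hδ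
      hz9 hz10 hz11 hz12 hne h11 h12
    have hCe : ![C 0, C 1, C 2, C 3] = C := by
      funext i
      fin_cases i <;> rfl
    refine ⟨C 0, C 1, C 2, C 3, fun x hx hxb => ?_, fun x hx => ?_, ?_, fun hdet C' hC' => ?_⟩
    · rw [(h.integrable_and_expectedDividends hlam hlamb hmu hmub hb hd hδ hmodel (hX x hx)).2,
        ThresholdDividends.candidate_of_le hx hxb]
      rfl
    · rw [(h.integrable_and_expectedDividends hlam hlamb hmu hmub hb hd hδ hmodel
        (hX x (hb.le.trans hx))).2, h.candidate_of_ge hb hx]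
      rfl
    · rw [hCe, hC]
    · rw [hCe]
      exact Matrix.mulVec_injective_of_isUnit
        ((Matrix.isUnit_iff_isUnit_det _).2 (isUnit_iff_ne_zero.2 hdet)) (hC'.trans hC.symm)
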